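/- **Conventions.** "Small" and "set" refer to one universe $\mathcal U$; all categories have $\mathcal U$-small hom-sets. A *monoidal model category* is a biclosed monoidal category with a model structure satisfying the pushout-product axiom and the unit axiom ($q\otimes X$ and $X\otimes q$ are weak equivalences for every cofibrant $X$ and every trivial fibration $q:Q\to 1$ with $Q$ cofibrant). For a monoidal category $\mathcal V$, a *(tensored and cotensored) $\mathcal V$-category* $\mathcal M$ is a closed $\mathcal V$-module: an associative and unital action $v\odot x$ with hom objects and cotensors, naturally $\mathcal M(v\odot x,y)\cong\mathcal V(v,\mathrm{Hom}_{\mathcal V}(x,y))\cong\mathcal M(x,y^v)$. It is a *monoidal $\mathcal V$-category* if $\mathcal M$ is also monoidal and there are natural coherent isomorphisms $(v\odot x)\otimes y\cong v\odot(x\otimes y)$. A *model $\mathcal V$-category* is a $\mathcal V$-category with a model structure on $\mathcal M$ such that $\odot$ satisfies the pushout-product axiom and the unit axiom ($q\odot X\to 1\odot X$ is a weak equivalence for $X\in\mathcal M$ cofibrant and $q:Q\to 1$ a trivial fibration in $\mathcal V$ with $Q$ cofibrant). A *monoidal model $\mathcal V$-category* is a monoidal $\mathcal V$-category with a model structure making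 it both a monoidal model category and a model $\mathcal V$-category. For a class $I$ of morphisms, $I\text{-cof}_{\mathrm{reg}}$ is the class of transfinite compositions of pushouts of morphisms of $I$, and $I\otimes\mathcal M=\{f\otimes X: f\in I,\ X\in\mathcal M\}$. The class $I$ *permits the small object argument* if there are a set $I_0\subseteq I$, such that every member of $I$ is isomorphic as an arrow to a member of $I_0$, and a regular cardinal $\kappa$, such that for the domain $A$ of each member of $I_0$ the functor $\mathrm{Hom}(A,-)$ preserves the colimits of $\kappa$-indexed continuous sequences whose steps are pushouts of coproducts of morphisms of $I_0$. A set of *generating cofibrations* is a set $I$ such that the trivial fibrations are exactly the morphisms with the right lifting property with respect to $I$. A set $J'$ of trivial cofibrations is *weakly generating* if every morphism that has the right lifting property with respect to $J'$ and has fibrant codomain is a fibration. A model structure with trivial cofibrations $TC$ satisfies the *monoid axiom* if $(TC\otimes\mathcal M)\text{-cof}_{\mathrm{reg}}$ consists of weak equivalences. Let $S$ be a class of morphisms of a model $\mathcal V$-category $\mathcal M$. An object $Z$ is *$S$-local* if $\mathbf R\mathrm{Hom}_{\mathcal V}(B,Z)\to\mathbf R\mathrm{Hom}_{\mathcal V}(A,Z)$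 is a weak equivalence in $\mathcal V$ for every $A\to B$ in $S$; a morphism $A\to B$ is an *$S$-local equivalence* if this map is a weak equivalence for every $S$-local $Z$. The *$\mathcal V$-enriched left Bousfield localization* $L^{\mathcal V}_S\mathcal M$ *exists* if there is a model structure on $\mathcal M$ whose cofibrations are those of $\mathcal M$, whose weak equivalences are the $S$-local equivalences, and which makes the $\mathcal V$-category $\mathcal M$ a model $\mathcal V$-category; $L^{\mathcal V}_S\mathcal M$ is then $\mathcal M$ with this model structure. **Theorem.** Let $\mathcal V$ be a monoidal model category with a set of generating cofibrations $I_{\mathcal V}$. Let $\mathcal M$ be a cocomplete monoidal model $\mathcal V$-category whose tensor product is braided (for instance symmetric), with a set of weakly generating trivial cofibrations $J'$. Let $S$ be a class of cofibrations with cofibrant domain in $\mathcal M$ such that $L^{\mathcal V}_S\mathcal M$ exists. Let $S\,\square\,I_{\mathcal V}$ be the class of pushout-products, with respect to $\odot$, of a morphism of $S$ with a morphism of $I_{\mathcal V}$, and assume that $J'\cup(S\,\square\,I_{\mathcal V})$ permits the small object argument. If every morphism in $$\bigl((J'\cup(S\,\square\,I_{\mathcal V}))\otimes\mathcal M\bigr)\text{-cof}_{\mathrm{reg}}$$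 is a weak equivalence in $L^{\mathcal V}_S\mathcal M$, then $L^{\mathcal V}_S\mathcal M$ is a monoidal model $\mathcal V$-category and satisfies the monoid axiom. -/

import Mathlib

open CategoryTheory Limits MonoidalCategory HomotopicalAlgebra
open scoped MonoidalLeftAction

universe v u u'

/-! ### Model structures on a fixed category

A category may carry several model structures, so the model structure is an explicit argument. -/

namespace HomotopicalAlgebra.ModelCategory

variable {C : Type u} [Category.{v} C] (𝓜 : ModelCategory C)

/-- The weak equivalences of the model structure `𝓜`. -/
abbrev weq : MorphismProperty C := @weakEquivalences C _ 𝓜.categoryWithWeakEquivalences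

/-- The cofibrations of the model structure `𝓜`. -/
abbrev cof : MorphismProperty C := @cofibrations C _ 𝓜.categoryWithCofibrations

/-- The fibrations of the model structure `𝓜`. -/
abbrev fib : MorphismProperty C := @fibrations C _ 𝓜.categoryWithFibrations

/-- The trivial cofibrations of the model structure `𝓜`. -/
abbrev trivCof : MorphismProperty C := 𝓜.cof ⊓ 𝓜.weq

/-- The trivial fibrations of the model structure `𝓜`. -/
abbrev trivFib : MorphismProperty C := 𝓜.fib ⊓ 𝓜.weq

/-- `X` is cofibrant: the map from the initial object is a cofibration. -/
abbrev CofibrantObj (X : C) : Prop := letI := 𝓜; IsCofibrant X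

/-- `X` is fibrant: the map to the terminal object is a fibration. -/
abbrev FibrantObj (X : C) : Prop := letI := 𝓜; IsFibrant X

/-- A set of generating cofibrations: a set `I` of morphisms such that the trivial fibrations are
exactly the morphisms with the right lifting property with respect to `I`. -/
structure IsGeneratingCof (I : MorphismProperty C) : Prop where
  isSmall : MorphismProperty.IsSmall.{v} I
  trivFib_eq : 𝓜.trivFib = I.rlp

/-- A set of weakly generating trivial cofibrations: a set `J` of trivial cofibrations such that
every morphism which has a fibrant codomain and the right lifting property with respect to `J`
is a fibration. -/
structure IsWeaklyGeneratingTrivCof (J : MorphismProperty C) : Prop where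
  isSmall : MorphismProperty.IsSmall.{v} J
  le_trivCof : J ≤ 𝓜.trivCof
  fib_of_rlp : ∀ ⦃A B : C⦄ (f : A ⟶ B), J.rlp f → 𝓜.FibrantObj B → 𝓜.fib f

end HomotopicalAlgebra.ModelCategory

namespace CategoryTheory.MorphismProperty

variable {C : Type u} [Category.{v} C]

/-- `I`-cof_reg: the transfinite compositions (indexed by small well-ordered types) of base changes
(i.e. pushouts) of morphisms in `I`. -/
abbrev cofReg (I : MorphismProperty C) : MorphismProperty C :=
  transfiniteCompositions.{v} I.pushouts

/-- `I` permits the small object argument: up to isomorphism of arrows `I` is given by a set of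
morphisms, and Mathlib's smallness condition for the domains of that set holds. -/
def PermitsSmallObjectArgument (I : MorphismProperty C) : Prop :=
  ∃ I₀ : MorphismProperty C, I₀ ≤ I ∧ I ≤ I₀.isoClosure ∧ HasSmallObjectArgument.{v} I₀

/-- `P ⊗ C`: the class of all morphisms `f ⊗ X` with `f` in `P` and `X` an object of `C`. -/
inductive tensorObjects [MonoidalCategory C] (P : MorphismProperty C) : MorphismProperty C
  | mk {A B : C} (f : A ⟶ B) (X : C) (hf : P f) : tensorObjects P (f ▷ X)

end CategoryTheory.MorphismProperty

/-! ### Monoidal model categories -/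

/-- The condition on pushout-products in the definition of a Quillen bifunctor: the pushout-product
of two cofibrations is a cofibration, which is trivial if one of the two is. -/
def PushoutProductAxiom {C₁ : Type*} {C₂ : Type*} {C₃ : Type*} [Category* C₁] [Category* C₂]
    [Category* C₃] (F : C₁ ⥤ C₂ ⥤ C₃) (𝓜₁ : ModelCategory C₁) (𝓜₂ : ModelCategory C₂)
    (𝓜₃ : ModelCategory C₃) : Prop :=
  ∀ ⦃A₁ B₁ : C₁⦄ ⦃A₂ B₂ : C₂⦄ (f₁ : A₁ ⟶ B₁) (f₂ : A₂ ⟶ B₂) (sq : F.PushoutObjObj f₁ f₂),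
    𝓜₁.cof f₁ → 𝓜₂.cof f₂ → 𝓜₃.cof sq.ι ∧ (𝓜₁.weq f₁ ∨ 𝓜₂.weq f₂ → 𝓜₃.weq sq.ι)

/-- A monoidal model category: the tensor product is closed (on both sides) and satisfies the
pushout-product axiom and the unit axiom. -/
structure IsMonoidalModelCategory {C : Type u} [Category.{v} C] [MonoidalCategory C]
    (𝓜 : ModelCategory C) : Prop where
  closed_left (X : C) : (tensorLeft X).IsLeftAdjoint
  closed_right (X : C) : (tensorRight X).IsLeftAdjoint
  pushoutProduct : PushoutProductAxiom (curriedTensor C) 𝓜 𝓜 𝓜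
  unit_left ⦃Q : C⦄ (q : Q ⟶ 𝟙_ C) (X : C) :
    𝓜.CofibrantObj Q → 𝓜.trivFib q → 𝓜.CofibrantObj X → 𝓜.weq (q ▷ X)
  unit_right ⦃Q : C⦄ (q : Q ⟶ 𝟙_ C) (X : C) :
    𝓜.CofibrantObj Q → 𝓜.trivFib q → 𝓜.CofibrantObj X → 𝓜.weq (X ◁ q)

/-- The monoid axiom: every morphism in `(TC ⊗ C)`-cof_reg is a weak equivalence, where `TC` is
the class of trivial cofibrations. -/
def MonoidAxiom {C : Type u} [Category.{v} C] [MonoidalCategory C] (𝓜 : ModelCategory C) : Prop :=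
  𝓜.trivCof.tensorObjects.cofReg ≤ 𝓜.weq

/-! ### `V`-categories and model `V`-categories -/

/-- A tensored and cotensored `V`-category with underlying category `M`, presented as a closed
`V`-module: an associative and unital action `v ⊙ₗ x` of `V` on `M` (the tensors), with hom objects
`homObj x y` in `V` and cotensors, related by an adjunction of two variables
`(v ⊙ₗ x ⟶ y) ≃ (v ⟶ homObj x y) ≃ (x ⟶ cotensor v y)`. -/
class ClosedModule (V : Type u') [Category.{v} V] [MonoidalCategory V]
    (M : Type u) [Category.{v} M] extends MonoidalLeftAction V M where
  /-- the hom objects in `V` -/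
  homObj : Mᵒᵖ ⥤ M ⥤ V
  /-- the cotensors -/
  cotensor : Vᵒᵖ ⥤ M ⥤ M
  /-- the adjunction between tensors and hom objects -/
  homAdj : (MonoidalLeftAction.curriedAction V M).flip ⊣₂ homObj
  /-- the adjunction between tensors and cotensors -/
  cotensorAdj : MonoidalLeftAction.curriedAction V M ⊣₂ cotensor

/-- A monoidal `V`-category: a tensored and cotensored `V`-category `M` with a monoidal structure
such that the functors `- ⊗ y` are `V`-linear, coherently with the associativity and the unit of
the action and of the tensor product of `M`. (Equivalently, the action is `v ⊙ₗ x = i v ⊗ x` for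
the strong monoidal functor `i v = v ⊙ₗ 𝟙_ M`.) -/
class MonoidalVCategory (V : Type u') [Category.{v} V] [MonoidalCategory V]
    (M : Type u) [Category.{v} M] [MonoidalCategory M] extends ClosedModule V M where
  /-- the isomorphism `(v ⊙ x) ⊗ y ≅ v ⊙ (x ⊗ y)` -/
  tensorIso (c : V) (x y : M) : (c ⊙ₗ x) ⊗ y ≅ c ⊙ₗ (x ⊗ y)
  tensorIso_naturality {c c' : V} {x x' y y' : M} (f : c ⟶ c') (g : x ⟶ x') (h : y ⟶ y') :
    ((f ⊙ₗₘ g) ⊗ₘ h) ≫ (tensorIso c' x' y').hom = (tensorIso c x y).hom ≫ (f ⊙ₗₘ (g ⊗ₘ h))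
  tensorIso_actionAssoc (c d : V) (x y : M) :
    (tensorIso (c ⊗ d) x y).hom ≫ (αₗ c d (x ⊗ y)).hom =
      (αₗ c d x).hom ▷ y ≫ (tensorIso c (d ⊙ₗ x) y).hom ≫ c ⊴ₗ (tensorIso d x y).hom
  tensorIso_actionUnit (x y : M) :
    (tensorIso (𝟙_ V) x y).hom ≫ (λₗ[V] (x ⊗ y)).hom = (λₗ[V] x).hom ▷ y
  tensorIso_associator (c : V) (x y z : M) :
    (tensorIso c x y).hom ▷ z ≫ (tensorIso c (x ⊗ y) z).hom ≫ c ⊴ₗ (α_ x y z).hom =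
      (α_ (c ⊙ₗ x) y z).hom ≫ (tensorIso c x (y ⊗ z)).hom
  tensorIso_rightUnitor (c : V) (x : M) :
    (tensorIso c x (𝟙_ M)).hom ≫ c ⊴ₗ (ρ_ x).hom = (ρ_ (c ⊙ₗ x)).hom

section

variable {V : Type u'} [Category.{v} V] [MonoidalCategory V] {M : Type u} [Category.{v} M]

/-- A model `V`-category: the tensoring of the `V`-category `M` over `V` satisfies the
pushout-product axiom and the unit axiom. -/
structure IsModelVCategory [ClosedModule V M] (𝓥 : ModelCategory V) (𝓜 : ModelCategory M) :
    Prop where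
  pushoutProduct : PushoutProductAxiom (MonoidalLeftAction.curriedAction V M) 𝓥 𝓜 𝓜
  unit ⦃Q : V⦄ (q : Q ⟶ 𝟙_ V) (X : M) :
    𝓥.CofibrantObj Q → 𝓥.trivFib q → 𝓜.CofibrantObj X → 𝓜.weq (q ⊵ₗ X)

/-- A monoidal model `V`-category: a monoidal `V`-category with a model structure that makes it
both a monoidal model category and a model `V`-category. -/
structure IsMonoidalModelVCategory [MonoidalCategory M] [MonoidalVCategory V M]
    (𝓥 : ModelCategory V) (𝓜 : ModelCategory M) : Prop where
  isMonoidalModelCategory : IsMonoidalModelCategory 𝓜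
  isModelVCategory : IsModelVCategory 𝓥 𝓜

/-- `S □ I`: the class of all pushout-products of a morphism of `M` in `S` and a morphism of `V`
in `I`, formed with the tensoring of `M` over `V`. -/
inductive pushoutProducts [ClosedModule V M] [HasPushouts M] (S : MorphismProperty M)
    (I : MorphismProperty V) : MorphismProperty M
  | mk {A B : M} {K L : V} (s : A ⟶ B) (i : K ⟶ L) (hs : S s) (hi : I i) :
      pushoutProducts S I
        (Functor.PushoutObjObj.ofHasPushout (MonoidalLeftAction.curriedAction V M) i s).ι

/-! ### Enriched left Bousfield localizations -/

/-- `f` induces a weak equivalence `RHom_V(B, Z) ⟶ RHom_V(A, Z)` in `V` of derived hom objects.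
These are the hom objects from a cofibrant approximation `f'` of `f` to a fibrant approximation
`Z'` of `Z`; whether the condition holds does not depend on the approximations. -/
def IsRHomEquiv [ClosedModule V M] (𝓥 : ModelCategory V) (𝓜 : ModelCategory M)
    {A B : M} (f : A ⟶ B) (Z : M) : Prop :=
  ∀ ⦃A' B' Z' : M⦄ (f' : A' ⟶ B') (a : A' ⟶ A) (b : B' ⟶ B) (z : Z ⟶ Z'),
    f' ≫ b = a ≫ f → 𝓜.CofibrantObj A' → 𝓜.CofibrantObj B' → 𝓜.FibrantObj Z' →
    𝓜.weq a → 𝓜.weq b → 𝓜.weq z →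
    𝓥.weq (((ClosedModule.homObj (V := V)).map f'.op).app Z')

/-- `Z` is `V`-enriched `S`-local. -/
def IsEnrichedLocal [ClosedModule V M] (𝓥 : ModelCategory V) (𝓜 : ModelCategory M)
    (S : MorphismProperty M) (Z : M) : Prop :=
  ∀ ⦃A B : M⦄ (s : A ⟶ B), S s → IsRHomEquiv 𝓥 𝓜 s Z

/-- `f` is a `V`-enriched `S`-local equivalence. -/
def IsEnrichedLocalEquiv [ClosedModule V M] (𝓥 : ModelCategory V) (𝓜 : ModelCategory M)
    (S : MorphismProperty M) {A B : M} (f : A ⟶ B) : Prop :=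
  ∀ ⦃Z : M⦄, IsEnrichedLocal 𝓥 𝓜 S Z → IsRHomEquiv 𝓥 𝓜 f Z

/-- The model structure `𝓛` is the `V`-enriched left Bousfield localization of `𝓜` at `S`: it makes
the `V`-category `M` into a model `V`-category, it has the same cofibrations as `𝓜`, and its weak
equivalences are the `V`-enriched `S`-local equivalences. -/
structure IsEnrichedBousfieldLocalization [ClosedModule V M] (𝓥 : ModelCategory V)
    (𝓜 : ModelCategory M) (S : MorphismProperty M) (𝓛 : ModelCategory M) : Prop where
  isModelVCategory : IsModelVCategory 𝓥 𝓛
  cof_eq : 𝓛.cof = 𝓜.cof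
  weq_iff : ∀ ⦃A B : M⦄ (f : A ⟶ B), 𝓛.weq f ↔ IsEnrichedLocalEquiv 𝓥 𝓜 S f

end

-- Write `Λ` for `J' ⊔ pushoutProducts S I_V`, and call a morphism cellular if it is a transfinite
-- composition of pushouts of coproducts of members of `Λ`.
--
-- The set-theoretic input is that `Λ` detects fibrations of the localization `LSM` over fibrant
-- codomains (`IsEnrichedBousfieldLocalization.fib_of_rlp`). If `X ⟶ Y` has the right lifting
-- property with respect to `Λ` and `Y` is fibrant in `LSM`, it is a fibration of `𝓜` because of
-- `J'`. Lifting against the pushout-products means, by adjunction, that `X` is as local as `Y`. A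
-- local fibrant object is fibrant in `LSM`, and fibrations of `𝓜` between such objects are
-- fibrations of `LSM`.
--
-- A trivial cofibration `f : A ⟶ B` of `LSM` need not be a retract of a cellular morphism, since
-- the usual factorization of `f` is controlled only over a fibrant codomain. So `B` is first mapped
-- to a fibrant `Z` by a cellular `g`, and `f ≫ g` is factored as a cellular `i` followed by a
-- fibration `q`. A lift `x : B ⟶ W` gives `f ≫ x = i` and `x ≫ q = g`, both cellular: `f` satisfies
-- a two-out-of-six condition relative to cellular morphisms (`exists_cellular`).
--
-- Tensoring with an object preserves this, with the cellular morphisms replaced by a class `K` of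
-- weak equivalences closed under cobase change and transfinite composition. The two-out-of-six
-- class of such a `K` is itself closed under transfinite compositions of pushouts
-- (`transfiniteCompositions_twoOutOfSix_le`), and weak equivalences satisfy two-out-of-six. This is
-- the monoid axiom. The pushout-product axiom follows by two-out-of-three.

universe w

/-! ### Chains

A presentation of transfinite compositions in terms of elements instead of cocones. -/

namespace CategoryTheory.MorphismProperty

/-- A transfinite sequence of shape `J` with colimit `Y`, whose steps belong to `P`. -/
structure Chain {C : Type u} [Category.{v} C] (P : MorphismProperty C) (J : Type w) [LinearOrder J]
    [SuccOrder J] (Y : C) where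
  /-- the objects of the sequence -/
  obj : J → C
  /-- the transition maps -/
  map : ∀ ⦃i j : J⦄, i ≤ j → (obj i ⟶ obj j)
  map_refl : ∀ i, map (le_refl i) = 𝟙 _
  map_trans : ∀ ⦃i j k : J⦄ (h : i ≤ j) (h' : j ≤ k), map h ≫ map h' = map (h.trans h')
  /-- the maps to the colimit -/
  incl : ∀ j, obj j ⟶ Y
  map_incl : ∀ ⦃i j : J⦄ (h : i ≤ j), map h ≫ incl j = incl i
  exists_lim_desc : ∀ m, Order.IsSuccLimit m → ∀ (T : C) (φ : ∀ i, i < m → (obj i ⟶ T)),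
    (∀ i i' (h : i ≤ i') (hi' : i' < m), map h ≫ φ i' hi' = φ i (h.trans_lt hi')) →
    ∃ ψ : obj m ⟶ T, ∀ i (hi : i < m), map hi.le ≫ ψ = φ i hi
  lim_ext : ∀ m, Order.IsSuccLimit m → ∀ (T : C) (ψ ψ' : obj m ⟶ T),
    (∀ i (hi : i < m), map hi.le ≫ ψ = map hi.le ≫ ψ') → ψ = ψ'
  exists_desc : ∀ (T : C) (φ : ∀ i, obj i ⟶ T),
    (∀ i i' (h : i ≤ i'), map h ≫ φ i' = φ i) → ∃ ψ : Y ⟶ T, ∀ i, incl i ≫ ψ = φ i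
  ext : ∀ (T : C) (ψ ψ' : Y ⟶ T), (∀ i, incl i ≫ ψ = incl i ≫ ψ') → ψ = ψ'
  step : ∀ j, ¬ IsMax j → P (map (Order.le_succ j))

variable {C : Type u} [Category.{v} C] {P Q : MorphismProperty C}

namespace Chain

variable {J : Type w} [LinearOrder J] [SuccOrder J]

attribute [simp] map_refl

lemma map_trans_assoc {Y : C} (c : P.Chain J Y) ⦃i j k : J⦄ (h : i ≤ j) (h' : j ≤ k) {T : C}
    (f : c.obj k ⟶ T) : c.map h ≫ c.map h' ≫ f = c.map (h.trans h') ≫ f := by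
  rw [← Category.assoc, c.map_trans]

lemma map_incl_assoc {Y : C} (c : P.Chain J Y) ⦃i j : J⦄ (h : i ≤ j) {T : C} (f : Y ⟶ T) :
    c.map h ≫ c.incl j ≫ f = c.incl i ≫ f := by
  rw [← Category.assoc, c.map_incl]

/-- The functor given by a chain. -/
def functor {Y : C} (c : P.Chain J Y) : J ⥤ C where
  obj := c.obj
  map f := c.map (leOfHom f)
  map_id _ := c.map_refl _
  map_comp _ _ := (c.map_trans _ _).symm

/-- The cocone given by a chain. -/
def cocone {Y : C} (c : P.Chain J Y) : Cocone c.functor where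
  pt := Y
  ι :=
    { app := c.incl
      naturality _ _ _ := (c.map_incl _).trans (Category.comp_id _).symm }

lemma nonempty_isColimit {Y : C} (c : P.Chain J Y) : Nonempty (IsColimit c.cocone) := by
  have h (s : Cocone c.functor) := c.exists_desc s.pt s.ι.app (fun i i' h ↦ s.w (homOfLE h))
  choose d hd using h
  exact ⟨{ desc := d, fac := hd, uniq s m hm := c.ext _ _ _ (fun i ↦ (hm i).trans (hd s i).symm) }⟩

lemma isWellOrderContinuous {Y : C} (c : P.Chain J Y) : c.functor.IsWellOrderContinuous where
  nonempty_isColimit m hm := by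
    have h (s : Cocone ((Set.principalSegIio m).monotone.functor ⋙ c.functor)) :=
      c.exists_lim_desc m hm s.pt (fun i hi ↦ s.ι.app ⟨i, hi⟩)
        (fun i i' h hi' ↦ s.w (j := ⟨i', hi'⟩) (j' := ⟨i, h.trans_lt hi'⟩) (homOfLE h))
    choose d hd using h
    exact ⟨{ desc := d
             fac s j := hd s j.1 j.2
             uniq s m' hm' := c.lim_ext m hm _ _ _
              (fun i hi ↦ (hm' ⟨i, hi⟩).trans (hd s i hi).symm) }⟩

variable [OrderBot J] [WellFoundedLT J]

lemma mem {Y : C} (c : P.Chain J Y) : P.transfiniteCompositionsOfShape J (c.incl ⊥) :=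
  ⟨{ F := c.functor
     isoBot := Iso.refl _
     isWellOrderContinuous := c.isWellOrderContinuous
     incl := c.cocone.ι
     isColimit := c.nonempty_isColimit.some
     fac := Category.id_comp _
     map_mem := c.step }⟩

/-- The chain given by a transfinite composition. -/
def ofTransfiniteComposition {X Y : C} {f : X ⟶ Y}
    (t : P.TransfiniteCompositionOfShape J f) : P.Chain J Y where
  obj := t.F.obj
  map _ _ h := t.F.map (homOfLE h)
  map_refl _ := t.F.map_id _
  map_trans _ _ _ _ _ := (t.F.map_comp _ _).symm
  incl := t.incl.app
  map_incl i j h := by simp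
  exists_lim_desc m hm T φ hφ := by
    let s : Cocone ((Set.principalSegIio m).monotone.functor ⋙ t.F) :=
      { pt := T
        ι :=
          { app i := φ i.1 i.2
            naturality i i' f := by
              exact (hφ i.1 i'.1 (leOfHom f) i'.2).trans (Category.comp_id _).symm } }
    exact ⟨(t.F.isColimitOfIsWellOrderContinuous m hm).desc s,
      fun i hi ↦ (t.F.isColimitOfIsWellOrderContinuous m hm).fac s ⟨i, hi⟩⟩
  lim_ext m hm T ψ ψ' h :=
    (t.F.isColimitOfIsWellOrderContinuous m hm).hom_ext (fun i ↦ h i.1 i.2)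
  exists_desc T φ hφ := by
    let s : Cocone t.F :=
      { pt := T
        ι :=
          { app := φ
            naturality i i' f := (hφ i i' (leOfHom f)).trans (Category.comp_id _).symm } }
    exact ⟨t.isColimit.desc s, t.isColimit.fac s⟩
  ext T ψ ψ' h := t.isColimit.hom_ext h
  step := t.map_mem

end Chain

instance : (transfiniteCompositions.{w} P).RespectsIso :=
  RespectsIso.of_respects_arrow_iso _ (fun f g e hf ↦ by
    rw [transfiniteCompositions_iff] at hf ⊢
    obtain ⟨J, _, _, _, _, hf⟩ := hf
    exact ⟨J, _, _, _, _, (arrow_mk_iso_iff _ e).1 hf⟩)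

lemma Chain.mem_transfiniteCompositions {J : Type w} [LinearOrder J] [SuccOrder J] [OrderBot J]
    [WellFoundedLT J] {Y : C} (c : P.Chain J Y) : transfiniteCompositions.{w} P (c.incl ⊥) :=
  transfiniteCompositionsOfShape_le_transfiniteCompositions _ _ _ c.mem

lemma transfiniteCompositions_iff_exists_chain {X Y : C} (f : X ⟶ Y) :
    transfiniteCompositions.{w} P f ↔
      ∃ (J : Type w) (_ : LinearOrder J) (_ : SuccOrder J) (_ : OrderBot J)
        (_ : WellFoundedLT J) (c : P.Chain J Y) (e : X ≅ c.obj ⊥), e.hom ≫ c.incl ⊥ = f := by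
  constructor
  · rw [transfiniteCompositions_iff]
    rintro ⟨J, _, _, _, _, ⟨t⟩⟩
    exact ⟨J, inferInstance, inferInstance, inferInstance, inferInstance,
      .ofTransfiniteComposition t, t.isoBot.symm, t.fac⟩
  · rintro ⟨J, _, _, _, _, c, e, rfl⟩
    exact RespectsIso.precomp _ e.hom _ c.mem_transfiniteCompositions

end CategoryTheory.MorphismProperty

/-! ### Transfinite compositions of transfinite compositions -/

/-- The disjoint union of a family of linear orders indexed by a linear order. It will be equipped
with the lexicographic order. -/
structure LexSigma {J : Type w} (K : J → Type w) where
  /-- the index -/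
  fst : J
  /-- the element -/
  snd : K fst

namespace LexSigma

variable {J : Type w} [LinearOrder J] {K : J → Type w} [∀ j, LinearOrder (K j)]

noncomputable instance : LinearOrder (LexSigma K) :=
  LinearOrder.lift' (fun a ↦ (toLex ⟨a.fst, a.snd⟩ : Σₗ j, K j)) (by
    rintro ⟨a, b⟩ ⟨a', b'⟩ h
    cases h
    rfl)

lemma mk_le_mk_iff {j j' : J} {k : K j} {k' : K j'} :
    (⟨j, k⟩ : LexSigma K) ≤ ⟨j', k'⟩ ↔ j < j' ∨ ∃ h : j = j', h ▸ k ≤ k' :=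
  Sigma.Lex.le_def

lemma mk_le_mk_iff_right {j : J} {k k' : K j} :
    (⟨j, k⟩ : LexSigma K) ≤ ⟨j, k'⟩ ↔ k ≤ k' := by
  simp [mk_le_mk_iff]

lemma mk_lt_mk_iff_right {j : J} {k k' : K j} :
    (⟨j, k⟩ : LexSigma K) < ⟨j, k'⟩ ↔ k < k' := by
  simp only [← not_le, mk_le_mk_iff_right]

lemma mk_lt_mk_of_lt {j j' : J} (h : j < j') (k : K j) (k' : K j') :
    (⟨j, k⟩ : LexSigma K) < ⟨j', k'⟩ :=
  Sigma.Lex.left _ _ h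

lemma fst_le_of_le {j j' : J} {k : K j} {k' : K j'}
    (h : (⟨j, k⟩ : LexSigma K) ≤ ⟨j', k'⟩) : j ≤ j' := by
  rw [mk_le_mk_iff] at h
  obtain h | ⟨rfl, h⟩ := h
  exacts [h.le, le_rfl]

instance wellFoundedLT [WellFoundedLT J] [∀ j, WellFoundedLT (K j)] :
    WellFoundedLT (LexSigma K) where
  wf := by
    have h := WellFounded.psigma_lex (r := fun (a b : J) ↦ a < b)
      (s := fun j (a b : K j) ↦ a < b) wellFounded_lt (fun _ ↦ wellFounded_lt)
    refine Subrelation.wf ?_ (InvImage.wf (fun a : LexSigma K ↦ (⟨a.fst, a.snd⟩ : PSigma K)) h)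
    rintro ⟨a, b⟩ ⟨a', b'⟩ (⟨_, _, h⟩ | ⟨_, _, h⟩)
    exacts [.left _ _ h, .right _ h]

noncomputable instance [WellFoundedLT J] [∀ j, WellFoundedLT (K j)] : SuccOrder (LexSigma K) :=
  .ofLinearWellFoundedLT _

instance [OrderBot J] [∀ j, OrderBot (K j)] : OrderBot (LexSigma K) where
  bot := ⟨⊥, ⊥⟩
  bot_le := fun ⟨j, k⟩ ↦ by
    obtain rfl | hj := eq_bot_or_bot_lt j
    · exact mk_le_mk_iff_right.2 bot_le
    · exact (mk_lt_mk_of_lt hj _ _).le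

lemma isSuccLimit_snd [∀ j, OrderBot (K j)] {j : J} {k : K j} (hk : k ≠ ⊥)
    (h : Order.IsSuccLimit (⟨j, k⟩ : LexSigma K)) : Order.IsSuccLimit k := by
  refine ⟨by simpa using hk, fun k' hk' ↦ h.2 ⟨j, k'⟩ ⟨mk_lt_mk_iff_right.2 hk'.lt, ?_⟩⟩
  rintro ⟨j'', k''⟩ h₁ h₂
  obtain rfl : j = j'' := le_antisymm (fst_le_of_le h₁.le) (fst_le_of_le h₂.le)
  exact hk'.2 (mk_lt_mk_iff_right.1 h₁) (mk_lt_mk_iff_right.1 h₂)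

lemma succ_mk_of_not_isMax [WellFoundedLT J] [∀ j, WellFoundedLT (K j)] [∀ j, SuccOrder (K j)]
    {j : J} {k : K j} (hk : ¬ IsMax k) :
    Order.succ (⟨j, k⟩ : LexSigma K) = ⟨j, Order.succ k⟩ := by
  refine (Order.succ_eq_of_covBy ⟨?_, ?_⟩)
  · exact mk_lt_mk_iff_right.2 (Order.lt_succ_of_not_isMax hk)
  · rintro ⟨j', k'⟩ h h'
    obtain rfl : j = j' := le_antisymm (fst_le_of_le h.le) (fst_le_of_le h'.le)
    rw [mk_lt_mk_iff_right] at h h'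
    exact (Order.lt_succ_iff_of_not_isMax hk).1 h' |>.not_gt h

lemma succ_mk_of_isMax [WellFoundedLT J] [∀ j, WellFoundedLT (K j)] [SuccOrder J]
    [∀ j, OrderBot (K j)] {j : J} {k : K j} (hj : ¬ IsMax j) (hk : IsMax k) :
    Order.succ (⟨j, k⟩ : LexSigma K) = ⟨Order.succ j, ⊥⟩ := by
  refine (Order.succ_eq_of_covBy ⟨?_, ?_⟩)
  · exact mk_lt_mk_of_lt (Order.lt_succ_of_not_isMax hj) _ _
  · rintro ⟨j', k'⟩ h h'
    obtain hjj | rfl := (fst_le_of_le h.le).lt_or_eq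
    · obtain rfl := le_antisymm (fst_le_of_le h'.le) (Order.succ_le_of_lt hjj)
      rw [mk_lt_mk_iff_right] at h'
      simp at h'
    · rw [mk_lt_mk_iff_right] at h
      exact hk.not_lt h

end LexSigma

/-! ### Refinement of a chain along the lexicographic order -/

namespace CategoryTheory.MorphismProperty.Chain

variable {C : Type u} [Category.{v} C] {P Q : MorphismProperty C}
  {J : Type w} [LinearOrder J] [SuccOrder J]
  {Y : C} (c : Q.Chain J Y) {K : J → Type w}
  [∀ j, LinearOrder (K j)] [∀ j, SuccOrder (K j)] [∀ j, OrderBot (K j)]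
  (d : ∀ j, P.Chain (K j) (c.obj (Order.succ j))) (e : ∀ j, c.obj j ≅ (d j).obj ⊥)

/-- The transition maps of the sequence obtained by refining the steps of a chain. -/
def lexMap (a b : LexSigma K) (h : a ≤ b) :
    (d a.fst).obj a.snd ⟶ (d b.fst).obj b.snd :=
  if h' : a.fst < b.fst then
    (d a.fst).incl a.snd ≫ c.map (Order.succ_le_of_lt h') ≫ (e b.fst).hom ≫
      (d b.fst).map bot_le
  else by
    obtain ⟨j, k⟩ := a
    obtain ⟨j', k'⟩ := b
    have hj : j = j' := le_antisymm (LexSigma.fst_le_of_le h) (not_lt.1 h')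
    subst hj
    exact (d j).map (LexSigma.mk_le_mk_iff_right.1 h)

lemma lexMap_of_lt {j j' : J} (hj : j < j') (k : K j) (k' : K j')
    (h : (⟨j, k⟩ : LexSigma K) ≤ ⟨j', k'⟩) :
    lexMap c d e ⟨j, k⟩ ⟨j', k'⟩ h =
      (d j).incl k ≫ c.map (Order.succ_le_of_lt hj) ≫ (e j').hom ≫ (d j').map bot_le :=
  dif_pos hj

lemma lexMap_right {j : J} (k k' : K j) (h : (⟨j, k⟩ : LexSigma K) ≤ ⟨j, k'⟩) :
    lexMap c d e ⟨j, k⟩ ⟨j, k'⟩ h =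
      (d j).map (LexSigma.mk_le_mk_iff_right.1 h) :=
  dif_neg (lt_irrefl j)

variable (he : ∀ j, (e j).hom ≫ (d j).incl ⊥ = c.map (Order.le_succ j))

include he in
lemma lexMap_trans (x y z : LexSigma K) (hxy : x ≤ y) (hyz : y ≤ z) :
    lexMap c d e x y hxy ≫ lexMap c d e y z hyz = lexMap c d e x z (hxy.trans hyz) := by
  obtain ⟨i, x⟩ := x
  obtain ⟨j, y⟩ := y
  obtain ⟨k, z⟩ := z
  obtain hij | rfl := (LexSigma.fst_le_of_le hxy).lt_or_eq
  · obtain hjk | rfl := (LexSigma.fst_le_of_le hyz).lt_or_eq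
    · rw [lexMap_of_lt c d e hij, lexMap_of_lt c d e hjk, lexMap_of_lt c d e (hij.trans hjk)]
      simp only [Category.assoc, map_incl_assoc, reassoc_of% he, map_trans_assoc]
    · rw [lexMap_of_lt c d e hij, lexMap_of_lt c d e hij, lexMap_right c d e]
      simp only [Category.assoc, map_trans]
  · obtain hjk | rfl := (LexSigma.fst_le_of_le hyz).lt_or_eq
    · rw [lexMap_of_lt c d e hjk, lexMap_of_lt c d e hjk, lexMap_right c d e, map_incl_assoc]
    · rw [lexMap_right c d e, lexMap_right c d e, lexMap_right c d e, map_trans]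

variable [OrderBot J]

-- A limit element `(j, k)` is of one of three kinds. If `k ≠ ⊥`, then `k` is a limit in `K j` and
-- `d j` is continuous there. If `k = ⊥` and `j` is a limit, `c` is continuous at `j`. If `k = ⊥`
-- and `j` is the successor of `j'`, then `c.obj j` is the colimit of `d j'`.
include he in
lemma exists_lexMap_desc [WellFoundedLT J] (m : LexSigma K) (hm : Order.IsSuccLimit m) (T : C)
    (φ : ∀ i : LexSigma K, i < m → ((d i.fst).obj i.snd ⟶ T))
    (hφ : ∀ i i' (h : i ≤ i') (hi' : i' < m),
      lexMap c d e i i' h ≫ φ i' hi' = φ i (h.trans_lt hi')) :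
    ∃ ψ : (d m.fst).obj m.snd ⟶ T,
      ∀ i (hi : i < m), lexMap c d e i m hi.le ≫ ψ = φ i hi := by
  obtain ⟨j, k⟩ := m
  by_cases hk : k = ⊥
  · subst hk
    have hlt {i : J} (hi : i < j) (k : K i) : (⟨i, k⟩ : LexSigma K) < ⟨j, ⊥⟩ :=
      LexSigma.mk_lt_mk_of_lt hi _ _
    have hfst {i : J} {k : K i} (hi : (⟨i, k⟩ : LexSigma K) < ⟨j, ⊥⟩) : i < j := by
      refine lt_of_le_of_ne (LexSigma.fst_le_of_le hi.le) ?_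
      rintro rfl
      rw [LexSigma.mk_lt_mk_iff_right] at hi
      simp at hi
    by_cases hj : Order.IsSuccLimit j
    · obtain ⟨ψ, hψ⟩ := c.exists_lim_desc j hj T
        (fun i hi ↦ (e i).hom ≫ φ ⟨i, ⊥⟩ (hlt hi _)) (fun i i' h hi' ↦ by
          obtain h | rfl := h.lt_or_eq
          · rw [← hφ ⟨i, ⊥⟩ ⟨i', ⊥⟩ (LexSigma.mk_lt_mk_of_lt h _ _).le (hlt hi' _),
              lexMap_of_lt c d e h]
            simp [reassoc_of% he, map_trans_assoc]
          · simp)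
      refine ⟨(e j).inv ≫ ψ, ?_⟩
      rintro ⟨i, k⟩ hi
      have hij : i < j := hfst hi
      have hs := hj.succ_lt hij
      -- `ψ` is known only on the bottoms of the blocks; a map out of block `i` passes through the
      -- bottom of block `succ i`, still below the limit `j`.
      rw [← hφ _ ⟨Order.succ i, ⊥⟩ (LexSigma.mk_lt_mk_of_lt
        (Order.lt_succ_of_not_isMax (not_isMax_iff.2 ⟨_, hij⟩)) _ _).le (hlt hs _)]
      change lexMap c d e ⟨i, k⟩ ⟨j, ⊥⟩ _ ≫ _ =
        lexMap c d e ⟨i, k⟩ ⟨_, ⊥⟩ _ ≫ _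
      rw [lexMap_of_lt c d e hij, lexMap_of_lt c d e
        (Order.lt_succ_of_not_isMax (not_isMax_iff.2 ⟨_, hij⟩))]
      simp [hψ _ hs]
    · obtain ⟨j', hj', rfl⟩ : ∃ j', ¬ IsMax j' ∧ Order.succ j' = j := by
        rw [Order.not_isSuccLimit_iff, Order.not_isSuccPrelimit_iff_succ_eq] at hj
        refine hj.resolve_left (fun hj ↦ ?_)
        obtain rfl := hj.eq_bot
        exact Order.not_isSuccLimit_bot hm
      have hlt' := Order.lt_succ_of_not_isMax hj'
      obtain ⟨ψ, hψ⟩ := (d j').exists_desc T (fun k ↦ φ ⟨j', k⟩ (hlt hlt' _))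
        (fun k k' h ↦ by
          rw [← hφ ⟨j', k⟩ ⟨j', k'⟩ (LexSigma.mk_le_mk_iff_right.2 h) (hlt hlt' _),
              lexMap_right c d e])
      refine ⟨(e _).inv ≫ ψ, ?_⟩
      rintro ⟨i, k⟩ hi
      obtain hij | rfl := (Order.le_of_lt_succ (hfst hi)).lt_or_eq
      · rw [← hφ _ ⟨j', ⊥⟩ (LexSigma.mk_lt_mk_of_lt hij _ _).le (hlt hlt' _),
          lexMap_of_lt c d e hij, lexMap_of_lt c d e (hfst hi), ← hψ]
        simp [reassoc_of% he, map_trans_assoc]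
      · rw [lexMap_of_lt c d e hlt']
        simp [hψ]
  · obtain ⟨ψ, hψ⟩ := (d j).exists_lim_desc k (LexSigma.isSuccLimit_snd hk hm) T
      (fun k' hk' ↦ φ ⟨j, k'⟩ (LexSigma.mk_lt_mk_iff_right.2 hk'))
      (fun k₁ k₂ h h₂ ↦ by
        rw [← hφ ⟨j, k₁⟩ ⟨j, k₂⟩ (LexSigma.mk_le_mk_iff_right.2 h)
          (LexSigma.mk_lt_mk_iff_right.2 h₂), lexMap_right c d e])
    refine ⟨ψ, ?_⟩
    rintro ⟨i, k'⟩ hi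
    obtain hij | rfl := (LexSigma.fst_le_of_le hi.le).lt_or_eq
    · have hbot : (⟨j, ⊥⟩ : LexSigma K) < ⟨j, k⟩ :=
        LexSigma.mk_lt_mk_iff_right.2 (bot_lt_iff_ne_bot.2 hk)
      rw [← hφ _ ⟨j, ⊥⟩ (LexSigma.mk_lt_mk_of_lt hij _ _).le hbot, ← hψ _
        (bot_lt_iff_ne_bot.2 hk), ← lexMap_right c d e _ _ hbot.le]
      exact (by rw [← lexMap_trans c d e he _ _ _ _ hbot.le, Category.assoc])
    · rw [lexMap_right c d e, hψ _ (LexSigma.mk_lt_mk_iff_right.1 hi)]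

include he in
lemma lexMap_ext [WellFoundedLT J] (m : LexSigma K) (hm : Order.IsSuccLimit m) (T : C)
    (ψ ψ' : (d m.fst).obj m.snd ⟶ T)
    (h : ∀ i (hi : i < m), lexMap c d e i m hi.le ≫ ψ = lexMap c d e i m hi.le ≫ ψ') :
    ψ = ψ' := by
  obtain ⟨j, k⟩ := m
  by_cases hk : k = ⊥
  · subst hk
    rw [← cancel_epi (e j).hom]
    by_cases hj : Order.IsSuccLimit j
    · refine c.lim_ext j hj T _ _ (fun i hi ↦ ?_)
      have := h ⟨i, ⊥⟩ (LexSigma.mk_lt_mk_of_lt hi _ _)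
      rw [lexMap_of_lt c d e hi] at this
      simpa [reassoc_of% he, map_trans_assoc] using (e i).hom ≫= this
    · obtain ⟨j', hj', rfl⟩ : ∃ j', ¬ IsMax j' ∧ Order.succ j' = j := by
        rw [Order.not_isSuccLimit_iff, Order.not_isSuccPrelimit_iff_succ_eq] at hj
        refine hj.resolve_left (fun hj ↦ ?_)
        obtain rfl := hj.eq_bot
        exact Order.not_isSuccLimit_bot hm
      have hlt := Order.lt_succ_of_not_isMax hj'
      refine (d j').ext T _ _ (fun k ↦ ?_)
      have := h ⟨j', k⟩ (LexSigma.mk_lt_mk_of_lt hlt _ _)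
      rw [lexMap_of_lt c d e hlt] at this
      simpa using this
  · refine (d j).lim_ext k (LexSigma.isSuccLimit_snd hk hm) T _ _ (fun k' hk' ↦ ?_)
    have := h ⟨j, k'⟩ (LexSigma.mk_lt_mk_iff_right.2 hk')
    rwa [lexMap_right c d e] at this

-- A largest index is terminal, so the colimit is attained there.
omit [OrderBot J] in
lemma isIso_incl_of_isMax {j : J} (hj : IsMax j) : IsIso (c.incl j) := by
  have hj' (i : J) : i ≤ j := hj.isTop i
  obtain ⟨ψ, hψ⟩ := c.exists_desc (c.obj j) (fun i ↦ c.map (hj' i))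
    (fun i i' h ↦ c.map_trans _ _)
  exact ⟨ψ, by simp [hψ], c.ext _ _ _ (fun i ↦ by simp [reassoc_of% hψ, map_incl])⟩

variable [∀ j, WellFoundedLT (K j)] [WellFoundedLT J]

/-- The refinement of a chain whose steps are given by chains. -/
noncomputable def lex (hP : isomorphisms C ≤ P) (hK : ∀ j, IsMax j → Subsingleton (K j)) :
    P.Chain (LexSigma K) Y where
  obj a := (d a.fst).obj a.snd
  map := lexMap c d e
  map_refl a := (lexMap_right c d e _ _ _).trans ((d _).map_refl _)
  map_trans := lexMap_trans c d e he
  incl a := (d a.fst).incl a.snd ≫ c.incl _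
  map_incl := by
    rintro ⟨i, k⟩ ⟨j, l⟩ h
    obtain hij | rfl := (LexSigma.fst_le_of_le h).lt_or_eq
    · rw [lexMap_of_lt c d e hij]
      simp [map_incl_assoc, reassoc_of% he, map_incl]
    · rw [lexMap_right c d e, map_incl_assoc]
  exists_lim_desc := exists_lexMap_desc c d e he
  lim_ext := lexMap_ext c d e he
  exists_desc T φ hφ := by
    obtain ⟨ψ, hψ⟩ := c.exists_desc T (fun j ↦ (e j).hom ≫ φ ⟨j, ⊥⟩) (fun i j h ↦ by
      obtain h | rfl := h.lt_or_eq
      · rw [← hφ ⟨i, ⊥⟩ ⟨j, ⊥⟩ (LexSigma.mk_lt_mk_of_lt h _ _).le, lexMap_of_lt c d e h]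
        simp [reassoc_of% he, map_trans_assoc]
      · simp)
    refine ⟨ψ, ?_⟩
    rintro ⟨j, k⟩
    -- No block follows a maximal `j`, so a morphism out of `(j, k)` cannot be tested on a later
    -- bottom; `hK` leaves only `k = ⊥`.
    by_cases hj : IsMax j
    · have := hK j hj
      obtain rfl := Subsingleton.elim k ⊥
      rw [← cancel_epi (e j).hom, ← hψ]
      simp [reassoc_of% he, map_incl_assoc]
    · have hj' := Order.lt_succ_of_not_isMax hj
      rw [← hφ ⟨j, k⟩ ⟨Order.succ j, ⊥⟩ (LexSigma.mk_lt_mk_of_lt hj' _ _).le, lexMap_of_lt c d e hj']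
      simp [hψ]
  ext T ψ ψ' h := c.ext _ _ _ (fun j ↦ by
    simpa [reassoc_of% he, map_incl_assoc] using (e j).hom ≫= h ⟨j, ⊥⟩)
  step := by
    rintro ⟨j, k⟩ h
    have key {y : LexSigma K} (hy : Order.succ (⟨j, k⟩ : LexSigma K) = y)
        (hP : P (lexMap c d e ⟨j, k⟩ y (by rw [← hy]; exact Order.le_succ _))) :
        P (lexMap c d e _ _ (Order.le_succ ⟨j, k⟩)) := by
      subst hy
      exact hP
    -- Leaving a block through its last element is an isomorphism, namely the inclusion into the
    -- colimit followed by `e`. This is the use of `isomorphisms C ≤ P`.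
    by_cases hk : IsMax k
    · have hj : ¬ IsMax j := fun hj ↦ h (by
        rintro ⟨j', k'⟩ h'
        obtain rfl := (LexSigma.fst_le_of_le h').antisymm (hj (LexSigma.fst_le_of_le h'))
        rw [LexSigma.mk_le_mk_iff_right] at h' ⊢
        exact hk h')
      refine key (LexSigma.succ_mk_of_isMax hj hk) (hP _ ?_)
      rw [lexMap_of_lt c d e (Order.lt_succ_of_not_isMax hj)]
      have := (d j).isIso_incl_of_isMax hk
      simp only [map_refl, Category.id_comp, Category.comp_id]
      change IsIso _
      infer_instance
    · refine key (LexSigma.succ_mk_of_not_isMax hk) ?_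
      rw [lexMap_right c d e]
      exact (d j).step k hk

end CategoryTheory.MorphismProperty.Chain

namespace CategoryTheory.MorphismProperty

variable {C : Type u} [Category.{v} C] (P : MorphismProperty C)

lemma id_mem_transfiniteCompositionsOfShape_shrink (X : C) :
    P.transfiniteCompositionsOfShape (Shrink.{w} (Fin 1)) (𝟙 X) :=
  ((TransfiniteCompositionOfShape.id P X).ofOrderIso (orderIsoShrink.{w} (Fin 1)).symm).mem

/-- Each step is itself a transfinite composition; concatenating these sequences gives one indexed
by the lexicographic sum. -/
lemma isStableUnderTransfiniteComposition_transfiniteCompositions (hP : isomorphisms C ≤ P) :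
    (transfiniteCompositions.{w} P).IsStableUnderTransfiniteComposition.{w} where
  isStableUnderTransfiniteCompositionOfShape J _ _ _ _ := ⟨by
    rintro X Y f ⟨t⟩
    let c := Chain.ofTransfiniteComposition t
    have (j : J) : ∃ (K : Type w) (_ : LinearOrder K) (_ : SuccOrder K) (_ : OrderBot K)
        (_ : WellFoundedLT K) (d : P.Chain K (c.obj (Order.succ j))) (e : c.obj j ≅ d.obj ⊥),
          (IsMax j → Subsingleton K) ∧ e.hom ≫ d.incl ⊥ = c.map (Order.le_succ j) := by
      -- Here `succ j = j`, the transition map is an identity, and the one-element sequence is used.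
      by_cases hj : IsMax j
      · obtain ⟨t⟩ : P.transfiniteCompositionsOfShape (Shrink.{w} (Fin 1)) (c.map (Order.le_succ j)) := by
          have (i : J) (h : j = i) : P.transfiniteCompositionsOfShape (Shrink.{w} (Fin 1))
              (c.map h.le) := by
            subst h
            rw [c.map_refl]
            exact id_mem_transfiniteCompositionsOfShape_shrink P _
          exact this _ (Order.succ_eq_iff_isMax.2 hj).symm
        exact ⟨Shrink.{w} (Fin 1), inferInstance, inferInstance, inferInstance, inferInstance,
          .ofTransfiniteComposition t, t.isoBot.symm,
          fun _ ↦ (equivShrink.{w} (Fin 1)).symm.subsingleton, t.fac⟩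
      · have := c.step j hj
        rw [transfiniteCompositions_iff_exists_chain] at this
        obtain ⟨K, _, _, _, _, d, e, h⟩ := this
        exact ⟨K, _, _, _, ‹_›, d, e, fun h ↦ (hj h).elim, h⟩
    choose K _ _ _ _ d e hK he using this
    rw [transfiniteCompositions_iff_exists_chain]
    refine ⟨LexSigma K, inferInstance, inferInstance, inferInstance, inferInstance,
      c.lex d e he hP hK, t.isoBot.symm ≪≫ e ⊥, ?_⟩
    have : t.isoBot.inv ≫ c.incl ⊥ = f := t.fac
    have h : c.incl ⊥ = (e ⊥).hom ≫ (d ⊥).incl ⊥ ≫ c.incl _ := by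
      rw [reassoc_of% he, c.map_incl]
    exact (Category.assoc _ _ _).trans ((congrArg (t.isoBot.inv ≫ ·) h.symm).trans this)⟩

end CategoryTheory.MorphismProperty

/-! ### Pushouts and coproducts of sequences -/

/-! ### Constructions of chains -/

namespace CategoryTheory

lemma IsPushout.of_exists_of_ext {C : Type u} [Category.{v} C] {A B X Y : C} {f : A ⟶ X}
    {g : A ⟶ B} {inl : X ⟶ Y} {inr : B ⟶ Y} (w : f ≫ inl = g ≫ inr)
    (h : ∀ (T : C) (x : X ⟶ T) (y : B ⟶ T), f ≫ x = g ≫ y →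
      ∃ ψ : Y ⟶ T, inl ≫ ψ = x ∧ inr ≫ ψ = y)
    (h' : ∀ (T : C) (ψ ψ' : Y ⟶ T), inl ≫ ψ = inl ≫ ψ' → inr ≫ ψ = inr ≫ ψ' → ψ = ψ') :
    IsPushout f g inl inr := by
  have h (s : PushoutCocone f g) := h s.pt s.inl s.inr s.condition
  choose d hd hd' using h
  exact ⟨⟨w⟩, ⟨PushoutCocone.IsColimit.mk _ d hd hd' (fun s m hm hm' ↦
    h' _ _ _ (hm.trans (hd s).symm) (hm'.trans (hd' s).symm))⟩⟩

namespace MorphismProperty.Chain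

variable {C : Type u} [Category.{v} C] {P Q R : MorphismProperty C}
  {J : Type w} [LinearOrder J] [SuccOrder J]

/-- Change the class of morphisms containing the steps of a chain. -/
def ofStep {Y : C} (c : Q.Chain J Y) (h : ∀ j, ¬ IsMax j → P (c.map (Order.le_succ j))) :
    P.Chain J Y where
  __ := c
  step := h

/-- The constant chain. -/
def const (J : Type w) [LinearOrder J] [SuccOrder J] [OrderBot J] (Y : C) :
    (⊤ : MorphismProperty C).Chain J Y where
  obj _ := Y
  map _ _ _ := 𝟙 Y
  map_refl _ := rfl
  map_trans _ _ _ _ _ := Category.comp_id _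
  incl _ := 𝟙 Y
  map_incl _ _ _ := Category.comp_id _
  exists_lim_desc m hm T φ hφ := ⟨φ ⊥ hm.bot_lt, fun i hi ↦ by simpa using! (hφ ⊥ i bot_le hi).symm⟩
  lim_ext m hm T ψ ψ' h := by simpa using h ⊥ hm.bot_lt
  exists_desc T φ hφ := ⟨φ ⊥, fun i ↦ by simpa using! (hφ ⊥ i bot_le).symm⟩
  ext T ψ ψ' h := by simpa using h ⊥
  step _ _ := trivial

variable {B W N : C} (b : Q.Chain J B) (d : R.Chain J W) (n : P.Chain J N)

/-- A morphism of chains. -/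
structure Hom where
  /-- the morphisms between the objects of the sequences -/
  app : ∀ j, b.obj j ⟶ n.obj j
  /-- the morphism between the colimits -/
  right : B ⟶ N
  naturality : ∀ ⦃i j⦄ (h : i ≤ j), b.map h ≫ app j = app i ≫ n.map h
  w : ∀ j, b.incl j ≫ right = app j ≫ n.incl j

namespace Hom

variable {b n} (β : Hom b n)

lemma naturality_assoc ⦃i j : J⦄ (h : i ≤ j) {T : C} (f : n.obj j ⟶ T) :
    b.map h ≫ β.app j ≫ f = β.app i ≫ n.map h ≫ f := by
  rw [← Category.assoc, β.naturality, Category.assoc]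

lemma w_assoc (j : J) {T : C} (f : N ⟶ T) :
    b.incl j ≫ β.right ≫ f = β.app j ≫ n.incl j ≫ f := by
  rw [← Category.assoc, β.w, Category.assoc]

end Hom

variable {b d n}

/-- The pushout of chains. -/
noncomputable def pushout [HasPushouts C] (β : Hom b n) (γ : Hom b d) :
    (⊤ : MorphismProperty C).Chain J (Limits.pushout β.right γ.right) where
  obj j := Limits.pushout (β.app j) (γ.app j)
  map i j h := pushout.desc (n.map h ≫ pushout.inl _ _) (d.map h ≫ pushout.inr _ _) (by
    rw [← β.naturality_assoc, ← γ.naturality_assoc, pushout.condition])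
  map_refl i := by ext <;> simp
  map_trans i j k h h' := by ext <;>
    simp [pushout.inl_desc, pushout.inl_desc_assoc, pushout.inr_desc, pushout.inr_desc_assoc,
      n.map_trans_assoc, d.map_trans_assoc]
  incl j := pushout.desc (n.incl j ≫ pushout.inl _ _) (d.incl j ≫ pushout.inr _ _) (by
    rw [← β.w_assoc, ← γ.w_assoc, pushout.condition])
  map_incl i j h := by ext <;>
    simp [pushout.inl_desc, pushout.inl_desc_assoc, pushout.inr_desc, pushout.inr_desc_assoc,
      map_incl_assoc]
  exists_lim_desc m hm T φ hφ := by
    obtain ⟨ψ₁, hψ₁⟩ := n.exists_lim_desc m hm T (fun i hi ↦ pushout.inl _ _ ≫ φ i hi)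
      (fun i i' h hi' ↦ by
        simp [← hφ i i' h hi', pushout.inl_desc_assoc])
    obtain ⟨ψ₂, hψ₂⟩ := d.exists_lim_desc m hm T (fun i hi ↦ pushout.inr _ _ ≫ φ i hi)
      (fun i i' h hi' ↦ by
        simp [← hφ i i' h hi', pushout.inr_desc_assoc])
    refine ⟨pushout.desc ψ₁ ψ₂ (b.lim_ext m hm T _ _ (fun i hi ↦ ?_)),
      fun i hi ↦ ?_⟩
    · rw [β.naturality_assoc, γ.naturality_assoc, hψ₁, hψ₂, pushout.condition_assoc]
      assumption
    · ext <;>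
        simp [pushout.inl_desc, pushout.inl_desc_assoc, pushout.inr_desc, pushout.inr_desc_assoc,
          hψ₁ i hi, hψ₂ i hi]
  lim_ext m hm T ψ ψ' h := by
    ext
    · refine n.lim_ext m hm _ _ _ (fun i hi ↦ ?_)
      simpa [pushout.inl_desc_assoc] using pushout.inl _ _ ≫= h i hi
    · refine d.lim_ext m hm _ _ _ (fun i hi ↦ ?_)
      simpa [pushout.inr_desc_assoc] using pushout.inr _ _ ≫= h i hi
  exists_desc T φ hφ := by
    obtain ⟨ψ₁, hψ₁⟩ := n.exists_desc T (fun i ↦ pushout.inl _ _ ≫ φ i)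
      (fun i i' h ↦ by
        simp [← hφ i i' h, pushout.inl_desc_assoc])
    obtain ⟨ψ₂, hψ₂⟩ := d.exists_desc T (fun i ↦ pushout.inr _ _ ≫ φ i)
      (fun i i' h ↦ by
        simp [← hφ i i' h, pushout.inr_desc_assoc])
    refine ⟨pushout.desc ψ₁ ψ₂ (b.ext T _ _ (fun i ↦ ?_)), fun i ↦ ?_⟩
    · rw [β.w_assoc, γ.w_assoc, hψ₁, hψ₂, pushout.condition_assoc]
    · ext <;>
        simp [pushout.inl_desc, pushout.inl_desc_assoc, pushout.inr_desc, pushout.inr_desc_assoc,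
          hψ₁, hψ₂]
  ext T ψ ψ' h := by
    ext
    · refine n.ext _ _ _ (fun i ↦ ?_)
      simpa [pushout.inl_desc_assoc] using pushout.inl _ _ ≫= h i
    · refine d.ext _ _ _ (fun i ↦ ?_)
      simpa [pushout.inr_desc_assoc] using pushout.inr _ _ ≫= h i
  step _ _ := trivial

/-- The chain of coproducts of the members of a family whose indices are sent below a given
element. -/
noncomputable def sigma [HasCoproducts.{w} C] {ι : Type w} (B : ι → C) (p : ι → J)
    (hp : ∀ i, ¬ IsMax (p i)) : (⊤ : MorphismProperty C).Chain J (∐ B) where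
  obj j := ∐ (fun i : { i // p i < j } ↦ B i.1)
  map j j' h := Limits.Sigma.desc (fun i ↦ Limits.Sigma.ι (fun i : { i // p i < j' } ↦ B i.1)
    ⟨i.1, i.2.trans_le h⟩)
  map_refl j := by ext; simp
  map_trans j₁ j₂ j₃ h h' := by ext; simp
  incl j := Limits.Sigma.desc (fun i ↦ Limits.Sigma.ι B i.1)
  map_incl j j' h := by ext; simp
  exists_lim_desc m hm T φ hφ := by
    -- The summand `i` already occurs at stage `succ (p i)`, which lies below the limit `m`.
    refine ⟨Limits.Sigma.desc (fun i ↦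
      Limits.Sigma.ι (fun k : { k // p k < Order.succ (p i.1) } ↦ B k.1)
      ⟨i.1, Order.lt_succ_of_not_isMax (hp _)⟩ ≫ φ _ (hm.succ_lt i.2)), fun j hj ↦ ?_⟩
    ext i
    simp [← hφ (Order.succ (p i.1)) j (Order.succ_le_of_lt i.2) hj]
  lim_ext m hm T ψ ψ' h := by
    ext i
    simpa using Limits.Sigma.ι (fun k : { k // p k < Order.succ (p i.1) } ↦ B k.1)
      ⟨i.1, Order.lt_succ_of_not_isMax (hp _)⟩ ≫= h _ (hm.succ_lt i.2)
  exists_desc T φ hφ := by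
    refine ⟨Limits.Sigma.desc (fun i ↦
      Limits.Sigma.ι (fun k : { k // p k < Order.succ (p i) } ↦ B k.1)
      ⟨i, Order.lt_succ_of_not_isMax (hp _)⟩ ≫ φ _), fun j ↦ ?_⟩
    ext i
    simp [← hφ (Order.succ (p i.1)) j (Order.succ_le_of_lt i.2)]
  ext T ψ ψ' h := by
    ext i
    simpa using Limits.Sigma.ι (fun k : { k // p k < Order.succ (p i) } ↦ B k.1)
      ⟨i, Order.lt_succ_of_not_isMax (hp _)⟩ ≫= h (Order.succ (p i))
  step _ _ := trivial

end MorphismProperty.Chain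

end CategoryTheory

/-! ### Stability properties of transfinite compositions -/

namespace CategoryTheory.MorphismProperty

variable {C : Type u} [Category.{v} C] {P Q : MorphismProperty C}

section

variable {J : Type w} [LinearOrder J] [SuccOrder J] [OrderBot J] {Y : C} (c : P.Chain J Y)
  {A : C} (a : c.obj ⊥ ⟶ A)

/-- The morphism from the constant chain to a chain. -/
def Chain.fromConst : (Chain.const J (c.obj ⊥)).Hom c where
  app _ := c.map bot_le
  right := c.incl ⊥
  naturality _ _ _ := (Category.id_comp _).trans (c.map_trans _ _).symm
  w _ := (Category.id_comp _).trans (c.map_incl _).symm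

/-- The morphism of constant chains given by a morphism. -/
def Chain.constMap (J : Type w) [LinearOrder J] [SuccOrder J] [OrderBot J] {A B : C} (a : A ⟶ B) :
    (Chain.const J A).Hom (Chain.const J B) where
  app _ := a
  right := a
  naturality _ _ _ := (Category.id_comp _).trans (Category.comp_id _).symm
  w _ := (Category.id_comp _).trans (Category.comp_id _).symm

/-- The cobase change of a chain. -/
noncomputable def Chain.cobaseChange [HasPushouts C] [P.IsStableUnderCobaseChange] :
    P.Chain J (Limits.pushout (c.incl ⊥) a) :=
  (Chain.pushout c.fromConst (Chain.constMap J a)).ofStep (fun j hj ↦ by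
    -- The stages are pushouts of `c.map bot_le` along `a`; cancelling the square at `j` from the
    -- square at `succ j` exhibits the step as a cobase change of the step of `c`.
    have h₁ : IsPushout a (c.map (bot_le (a := j))) (Limits.pushout.inr _ _)
      (Limits.pushout.inl _ _) := (IsPushout.of_hasPushout _ _).flip
    have h₂ : IsPushout a (c.map (bot_le (a := j)) ≫ c.map (Order.le_succ j))
        (Limits.pushout.inr (c.map bot_le) a ≫
          (Chain.pushout c.fromConst (Chain.constMap J a)).map (Order.le_succ j))
        (Limits.pushout.inl _ _) := by
      rw [c.map_trans, show Limits.pushout.inr (c.map bot_le) a ≫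
        (Chain.pushout c.fromConst (Chain.constMap J a)).map (Order.le_succ j) =
          Limits.pushout.inr _ _ from (Limits.pushout.inr_desc _ _ _).trans (Category.id_comp _)]
      exact (IsPushout.of_hasPushout _ _).flip
    exact of_isPushout (IsPushout.of_top h₂ (Limits.pushout.inl_desc _ _ _) h₁)
      (c.step j hj))

end

instance [HasPushouts C] [P.IsStableUnderCobaseChange] :
    (transfiniteCompositions.{w} P).IsStableUnderCobaseChange :=
  .mk' (fun X Y S f g _ hf ↦ by
    rw [transfiniteCompositions_iff_exists_chain] at hf
    obtain ⟨J, _, _, _, _, c, e, rfl⟩ := hf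
    let i := e.inv ≫ g
    let d := c.cobaseChange i
    have h₀ : IsPushout (c.map (le_refl ⊥)) i (Limits.pushout.inl _ _) (Limits.pushout.inr _ _) :=
      IsPushout.of_hasPushout (c.map bot_le) i
    have : IsIso (Y := d.obj ⊥) (Limits.pushout.inr (c.map (le_refl ⊥)) i) := by
      have : IsIso (c.map (le_refl ⊥)) := by rw [c.map_refl]; infer_instance
      exact h₀.isIso_inr_of_isIso
    have h₁ : IsPushout (c.incl ⊥) i (Limits.pushout.inl _ _) (Limits.pushout.inr _ _) :=
      IsPushout.of_hasPushout _ _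
    have h₂ : IsPushout (e.hom ≫ c.incl ⊥) g (Limits.pushout.inl _ _)
        (Limits.pushout.inr (c.incl ⊥) i) :=
      IsPushout.of_iso h₁ e.symm (Iso.refl _) (Iso.refl _) (Iso.refl _) (by simp) (by simp [i])
        (by simp) (by simp)
    rw [← (transfiniteCompositions.{w} P).cancel_right_of_respectsIso _
      (h₂.isoPushout.inv), IsPushout.inr_isoPushout_inv,
      transfiniteCompositions_iff_exists_chain]
    refine ⟨J, inferInstance, inferInstance, inferInstance, inferInstance, d,
      asIso (Y := d.obj ⊥) (Limits.pushout.inr (c.map (le_refl ⊥)) i), ?_⟩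
    exact (Limits.pushout.inr_desc _ _ _).trans (Category.id_comp _))

end CategoryTheory.MorphismProperty

/-! ### Enlarging the steps of a chain -/

namespace CategoryTheory.MorphismProperty.Chain

variable {C : Type u} [Category.{v} C]

section

variable {P Q R : MorphismProperty C} {J : Type w} [LinearOrder J] [SuccOrder J] [HasPushouts C]
  {B W N : C} {b : Q.Chain J B} {d : R.Chain J W} {n : P.Chain J N} (β : Hom b n) (γ : Hom b d)

/-- The first coprojection of a pushout of chains. -/
noncomputable def inl (j : J) : n.obj j ⟶ (Chain.pushout β γ).obj j :=
  Limits.pushout.inl (β.app j) (γ.app j)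

/-- The second coprojection of a pushout of chains. -/
noncomputable def inr (j : J) : d.obj j ⟶ (Chain.pushout β γ).obj j :=
  Limits.pushout.inr (β.app j) (γ.app j)

lemma isPushout_obj (j : J) : IsPushout (β.app j) (γ.app j) (inl β γ j) (inr β γ j) :=
  .of_hasPushout _ _

lemma inl_map {i j : J} (h : i ≤ j) :
    inl β γ i ≫ (Chain.pushout β γ).map h = n.map h ≫ inl β γ j :=
  Limits.pushout.inl_desc _ _ _

lemma inr_map {i j : J} (h : i ≤ j) :
    inr β γ i ≫ (Chain.pushout β γ).map h = d.map h ≫ inr β γ j :=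
  Limits.pushout.inr_desc _ _ _

lemma inl_incl (j : J) :
    inl β γ j ≫ (Chain.pushout β γ).incl j = n.incl j ≫ Limits.pushout.inl _ _ :=
  Limits.pushout.inl_desc _ _ _

end

section

variable [HasCoproducts.{w} C] {J : Type w} [LinearOrder J] [SuccOrder J] {K : Type w} (B : K → C)
  (p : K → J) (hp : ∀ i, ¬ IsMax (p i))

/-- The coprojections of a chain of coproducts. -/
noncomputable def coproj {j : J} (i : K) (h : p i < j) : B i ⟶ (sigma B p hp).obj j :=
  Limits.Sigma.ι (fun i : { i // p i < j } ↦ B i.1) ⟨i, h⟩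

@[simp]
lemma coproj_map {j j' : J} (i : K) (h : p i < j) (h' : j ≤ j') :
    coproj B p hp i h ≫ (sigma B p hp).map h' = coproj B p hp i (h.trans_le h') :=
  Limits.Sigma.ι_desc _ _

@[simp]
lemma coproj_incl {j : J} (i : K) (h : p i < j) :
    coproj B p hp i h ≫ (sigma B p hp).incl j = Limits.Sigma.ι B i :=
  Limits.Sigma.ι_desc _ _

@[simp]
lemma coproj_map_assoc {j j' : J} (i : K) (h : p i < j) (h' : j ≤ j') {T : C}
    (f : (sigma B p hp).obj j' ⟶ T) :
    coproj B p hp i h ≫ (sigma B p hp).map h' ≫ f = coproj B p hp i (h.trans_le h') ≫ f := by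
  rw [← Category.assoc, coproj_map]

@[simp]
lemma coproj_incl_assoc {j : J} (i : K) (h : p i < j) {T : C} (f : ∐ B ⟶ T) :
    coproj B p hp i h ≫ (sigma B p hp).incl j ≫ f = Limits.Sigma.ι B i ≫ f := by
  rw [← Category.assoc, coproj_incl]

variable {B p hp}

lemma sigma_hom_ext {j : J} {T : C} {f g : (sigma B p hp).obj j ⟶ T}
    (w : ∀ i h, coproj B p hp i h ≫ f = coproj B p hp i h ≫ g) : f = g :=
  Limits.Sigma.hom_ext _ _ (fun i ↦ w i.1 i.2)

/-- Morphisms out of the objects of a chain of coproducts. -/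
noncomputable def sigmaObjDesc {j : J} {T : C} (φ : ∀ i, p i < j → (B i ⟶ T)) :
    (sigma B p hp).obj j ⟶ T :=
  Limits.Sigma.desc (fun i ↦ φ i.1 i.2)

@[simp]
lemma coproj_sigmaObjDesc {j : J} {T : C} (φ : ∀ i, p i < j → (B i ⟶ T)) (i : K) (h : p i < j) :
    coproj B p hp i h ≫ sigmaObjDesc φ = φ i h :=
  Limits.Sigma.ι_desc _ _

@[simp]
lemma coproj_sigmaObjDesc_assoc {j : J} {T U : C} (φ : ∀ i, p i < j → (B i ⟶ T)) (i : K)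
    (h : p i < j) (f : T ⟶ U) :
    coproj B p hp i h ≫ sigmaObjDesc φ ≫ f = φ i h ≫ f := by
  rw [← Category.assoc, coproj_sigmaObjDesc]

/-- The morphism between chains of coproducts given by morphisms between the summands. -/
@[simps app]
noncomputable def sigmaMap (hp : ∀ i, ¬ IsMax (p i)) {W : K → C} (g : ∀ j, B j ⟶ W j) :
    (sigma B p hp).Hom (sigma W p hp) where
  app _ := sigmaObjDesc (fun i h ↦ g i ≫ coproj W p hp i h)
  right := Limits.Sigma.map g
  naturality j j' h := by
    refine sigma_hom_ext (fun i h ↦ ?_)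
    simp
  w j := by
    refine sigma_hom_ext (fun i h ↦ ?_)
    simp

/-- The morphism from a chain of coproducts given by morphisms to the objects of a chain. -/
@[simps app]
noncomputable def sigmaDesc {Q : MorphismProperty C} {Y : C} (c : Q.Chain J Y)
    (hp : ∀ i, ¬ IsMax (p i)) (b : ∀ i, B i ⟶ c.obj (Order.succ (p i))) :
    (sigma B p hp).Hom c where
  app _ := sigmaObjDesc (fun i h ↦ b i ≫ c.map (Order.succ_le_of_lt h))
  right := Limits.Sigma.desc (fun i ↦ b i ≫ c.incl _)
  naturality j j' h := by
    refine sigma_hom_ext (fun i h ↦ ?_)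
    simp [c.map_trans]
  w j := by
    refine sigma_hom_ext (fun i h ↦ ?_)
    simp [c.map_incl]

end

variable {P Q : MorphismProperty C} [HasCoproducts.{w} C]
  [HasPushouts C] {J : Type w} [LinearOrder J] [SuccOrder J] {Y : C} (c : Q.Chain J Y)
  {A B W : { j : J // ¬ IsMax j } → C} {u : ∀ j, A j ⟶ c.obj j.1} {a : ∀ j, A j ⟶ B j}
  {b : ∀ j, B j ⟶ c.obj (Order.succ j.1)}
  (sq : ∀ j, IsPushout (u j) (a j) (c.map (Order.le_succ j.1)) (b j)) (g : ∀ j, B j ⟶ W j)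

/-- The chain obtained by enlarging the steps of a chain. -/
noncomputable abbrev attach {Y : C} (c : Q.Chain J Y)
    (b : ∀ j : { j : J // ¬ IsMax j }, B j ⟶ c.obj (Order.succ j.1)) (g : ∀ j, B j ⟶ W j) :
    (⊤ : MorphismProperty C).Chain J
      (Limits.pushout (Limits.Sigma.desc (fun i ↦ b i ≫ c.incl _)) (Limits.Sigma.map g)) :=
  Chain.pushout (sigmaDesc c Subtype.property b) (sigmaMap Subtype.property g)

lemma coproj_inl (i : { j : J // ¬ IsMax j }) {j : J} (h : i.1 < j) :
    b i ≫ c.map (Order.succ_le_of_lt h) ≫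
      inl (sigmaDesc c Subtype.property b) (sigmaMap Subtype.property g) j =
    g i ≫ coproj W _ Subtype.property i h ≫
      inr (sigmaDesc c Subtype.property b) (sigmaMap Subtype.property g) j := by
  simpa using! coproj B _ Subtype.property i h ≫= (isPushout_obj
    (sigmaDesc c Subtype.property b) (sigmaMap Subtype.property g) j).w

-- Stage `j` is `c.obj j` with every `W i`, `i < j`, glued along `B i`. Passing to `succ j` attaches
-- `B j` along `a j` and then enlarges it to `W j`, which is a single pushout of `a j ≫ g j`.
include sq in
lemma isPushout_attach (j : { j : J // ¬ IsMax j }) :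
    IsPushout (u j ≫ inl (sigmaDesc c Subtype.property b) (sigmaMap Subtype.property g) j.1)
      (a j ≫ g j) ((attach c b g).map (Order.le_succ j.1))
      (coproj W _ Subtype.property j (Order.lt_succ_of_not_isMax j.2) ≫ inr _ _ (Order.succ j.1)) := by
  have hl := inl_map (sigmaDesc c Subtype.property b) (sigmaMap Subtype.property g)
    (Order.le_succ j.1)
  have hr := inr_map (sigmaDesc c Subtype.property b) (sigmaMap Subtype.property g)
    (Order.le_succ j.1)
  have h₀ : b j ≫ inl (sigmaDesc c Subtype.property b) (sigmaMap Subtype.property g) _ =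
      g j ≫ coproj W _ Subtype.property j (Order.lt_succ_of_not_isMax j.2) ≫
        inr _ _ (Order.succ j.1) := by
    simpa using coproj_inl c (b := b) g j (Order.lt_succ_of_not_isMax j.2)
  have hlt {i : { j : J // ¬ IsMax j }} (h : i.1 < Order.succ j.1) : i.1 < j.1 ∨ i = j := by
    rw [Subtype.ext_iff]
    exact (Order.le_of_lt_succ h).lt_or_eq
  refine .of_exists_of_ext ?_ (fun T x y hxy ↦ ?_) (fun T ψ ψ' h₁ h₂ ↦ ?_)
  · rw [Category.assoc, hl, ← Category.assoc, (sq j).w, Category.assoc, h₀, Category.assoc]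
  · simp only [Category.assoc] at hxy
    obtain ⟨φ, hφ₁, hφ₂⟩ := (sq j).exists_desc _ _ hxy
    have hw (i) (hi : i.1 < Order.succ j.1) : ∃ f : W i ⟶ T,
        (∀ h : i.1 < j.1, f = coproj W _ Subtype.property i h ≫ inr _ _ j.1 ≫ x) ∧
          (∀ h : i = j, f = eqToHom (by rw [h]) ≫ y) := by
      obtain h | rfl := hlt hi
      · exact ⟨coproj W _ Subtype.property i h ≫ inr _ _ j.1 ≫ x, fun _ ↦ rfl,
          by rintro rfl; simp at h⟩
      · exact ⟨y, by simp, by simp⟩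
    choose f hf hf' using hw
    obtain ⟨ψ, hψ, hψ'⟩ := (isPushout_obj (sigmaDesc c Subtype.property b)
      (sigmaMap Subtype.property g) (Order.succ j.1)).exists_desc φ (sigmaObjDesc f)
      (sigma_hom_ext (fun i hi ↦ by
        simp only [sigmaDesc_app, coproj_sigmaObjDesc_assoc, sigmaMap_app, Category.assoc, coproj_sigmaObjDesc]
        obtain h | rfl := hlt hi
        · rw [hf _ _ h, ← reassoc_of% coproj_inl c g i h,
            ← c.map_trans_assoc (Order.succ_le_of_lt h) (Order.le_succ _), hφ₁]
        · simp [hf' i hi rfl, hφ₂]))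
    refine ⟨ψ, ?_, by simp [hψ', hf' j]⟩
    refine (isPushout_obj _ _ _).hom_ext ?_ (sigma_hom_ext (fun i hi ↦ ?_))
    · rw [reassoc_of% hl, hψ, hφ₁]
    · rw [reassoc_of% hr, hψ', coproj_map_assoc, coproj_sigmaObjDesc, hf _ _ hi]
  · refine (isPushout_obj _ _ _).hom_ext ((sq j).hom_ext ?_ ?_) (sigma_hom_ext (fun i hi ↦ ?_))
    · rw [← reassoc_of% hl, ← reassoc_of% hl, h₁]
    · simp only [Category.assoc] at h₂
      rw [reassoc_of% h₀, reassoc_of% h₀, h₂]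
    · simp only [Category.assoc] at h₂
      obtain h | rfl := hlt hi
      · rw [← coproj_map_assoc _ _ _ i h (Order.le_succ j.1), ← coproj_map_assoc _ _ _ i h (Order.le_succ j.1),
          ← reassoc_of% hr, ← reassoc_of% hr, h₁]
      · exact h₂

include sq in
lemma transfiniteCompositions_attach [P.IsStableUnderCobaseChange] [OrderBot J] [WellFoundedLT J]
    (hP : ∀ j, P (a j ≫ g j)) :
    transfiniteCompositions.{w} P (c.incl ⊥ ≫
      Limits.pushout.inl (Limits.Sigma.desc (fun i ↦ b i ≫ c.incl _)) (Limits.Sigma.map g)) := by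
  -- No index lies below `⊥`, so nothing has been glued at the initial stage.
  have : IsIso (inl (sigmaDesc c Subtype.property b) (sigmaMap Subtype.property g) ⊥) := by
    have : IsIso ((sigmaMap Subtype.property g).app ⊥) :=
      ⟨sigmaObjDesc (fun i h ↦ (not_lt_bot h).elim), sigma_hom_ext (fun i h ↦ (not_lt_bot h).elim),
        sigma_hom_ext (fun i h ↦ (not_lt_bot h).elim)⟩
    exact (isPushout_obj _ _ _).isIso_inl_of_isIso
  rw [transfiniteCompositions_iff_exists_chain]
  exact ⟨J, inferInstance, inferInstance, inferInstance, inferInstance,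
    (attach c b g).ofStep (fun j hj ↦ of_isPushout (isPushout_attach c sq g ⟨j, hj⟩) (hP ⟨j, hj⟩)),
    asIso (Y := (attach c b g).obj ⊥) (inl (sigmaDesc c Subtype.property b) (sigmaMap Subtype.property g) ⊥),
    inl_incl _ _ _⟩

end CategoryTheory.MorphismProperty.Chain

/-! ### Coproducts and the two-out-of-six class -/

namespace CategoryTheory.MorphismProperty

variable {C : Type u} [Category.{v} C] {P : MorphismProperty C} [HasCoproducts.{w} C]
  [HasPushouts C]

/-- A sequence has one step for each non-maximal index. Adjoining a top to a well-ordering of `K`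
makes these indices correspond to `K`. -/
lemma exists_wellOrder_equiv_not_isMax (K : Type w) :
    ∃ (J : Type w) (_ : LinearOrder J) (_ : SuccOrder J) (_ : OrderBot J) (_ : WellFoundedLT J),
      Nonempty ({ j : J // ¬ IsMax j } ≃ K) := by
  classical
  let _ : LinearOrder K := linearOrderOfSTO WellOrderingRel
  have : WellFoundedLT K := inferInstanceAs (IsWellFounded K WellOrderingRel)
  let _ : SuccOrder (WithTop K) := SuccOrder.ofLinearWellFoundedLT _
  let _ : OrderBot (WithTop K) := WellFoundedLT.toOrderBot _
  exact ⟨WithTop K, inferInstance, inferInstance, inferInstance, inferInstance,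
    ⟨(Equiv.ofBijective (fun k ↦ ⟨(k : WithTop K), by simp [isMax_iff_eq_top]⟩)
      ⟨fun k k' h ↦ WithTop.coe_injective (congr_arg Subtype.val h), fun ⟨j, hj⟩ ↦ by
        rw [isMax_iff_eq_top] at hj
        obtain ⟨k, rfl⟩ := WithTop.ne_top_iff_exists.1 hj
        exact ⟨k, rfl⟩⟩).symm⟩⟩

lemma transfiniteCompositions_sigmaMap [P.IsStableUnderCobaseChange] {K : Type w} {A B : K → C}
    (f : ∀ i, A i ⟶ B i) (hf : ∀ i, P (f i)) :
    transfiniteCompositions.{w} P (Limits.Sigma.map f) := by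
  obtain ⟨J, _, _, _, _, ⟨e⟩⟩ := exists_wellOrder_equiv_not_isMax K
  -- The steps of the constant chain are pushouts of identities of the `A i`; enlarging them along
  -- `f` replaces the summands `A i` by `B i` one at a time.
  have h := (Chain.const J (∐ A)).transfiniteCompositions_attach (P := P)
    (u := fun j ↦ Limits.Sigma.ι A (e j)) (a := fun j ↦ 𝟙 _) (b := fun j ↦ Limits.Sigma.ι A (e j))
    (fun j ↦ by
      have : IsIso ((Chain.const J (∐ A)).map (Order.le_succ j.1)) := inferInstanceAs (IsIso (𝟙 _))
      exact .of_vert_isIso ⟨(Category.comp_id _).trans (Category.id_comp _).symm⟩)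
    (fun j ↦ f (e j)) (fun j ↦ by simpa using hf (e j))
  have hi (A : K → C) : IsIso (Limits.Sigma.desc (fun i ↦ Limits.Sigma.ι A (e i))) := by
    convert (Limits.Sigma.whiskerEquiv (f := fun i ↦ A (e i)) e (fun i ↦ Iso.refl _)).isIso_hom
    ext
    simp
  have sq : IsPushout (Limits.Sigma.desc (fun i ↦ Limits.Sigma.ι A (e i)))
      (Limits.Sigma.map (fun i ↦ f (e i))) (Limits.Sigma.map f)
      (Limits.Sigma.desc (fun i ↦ Limits.Sigma.ι B (e i))) :=
    have := hi A
    have := hi B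
    .of_horiz_isIso ⟨by ext; simp⟩
  have sq' : IsPushout (Limits.Sigma.desc (fun i ↦ Limits.Sigma.ι A (e i) ≫ 𝟙 (∐ A)))
      (Limits.Sigma.map (fun i ↦ f (e i))) (Limits.pushout.inl _ _) (Limits.pushout.inr _ _) :=
    .of_hasPushout _ _
  simp only [Category.comp_id] at sq'
  rw [← IsPushout.inl_isoIsPushout_inv _ _ sq sq']
  refine RespectsIso.postcomp (transfiniteCompositions.{w} P) _ _ ?_
  have h : transfiniteCompositions.{w} P (𝟙 _ ≫ Limits.pushout.inl
    (Limits.Sigma.desc (fun i ↦ Limits.Sigma.ι A (e i) ≫ 𝟙 (∐ A))) _) := h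
  rwa [Category.id_comp] at h

/-- The class of morphisms `f` such that `f ≫ x` and `x ≫ y` are in `P` for some `x` and `y`. -/
def twoOutOfSix (P : MorphismProperty C) : MorphismProperty C :=
  fun _ B f ↦ ∃ (W Z : C) (x : B ⟶ W) (y : W ⟶ Z), P (f ≫ x) ∧ P (x ≫ y)

/-- If the steps of `X ⟶ Y` are pushouts of `a j : A j ⟶ B j` with witnesses `x j`, `y j`, glue all
`W j` to `Y` along `∐ B`. The composite from `X` is then a transfinite composition of pushouts of `a
j ≫ x j`, while gluing in all `Z j` instead is a pushout of the coproduct of the `x j ≫ y j`. -/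
lemma transfiniteCompositions_twoOutOfSix_le [P.IsStableUnderCobaseChange]
    (hP : transfiniteCompositions.{w} P ≤ P) :
    transfiniteCompositions.{w} P.twoOutOfSix.pushouts ≤ P.twoOutOfSix := by
  intro X Y f hf
  rw [transfiniteCompositions_iff_exists_chain] at hf
  obtain ⟨J, _, _, _, _, c, e, rfl⟩ := hf
  have h (j : { j : J // ¬ IsMax j }) := c.step j.1 j.2
  choose A B a u b h sq using h
  choose W Z x y h₁ h₂ using h
  have h := c.transfiniteCompositions_attach sq x h₁
  refine ⟨_, _, Limits.pushout.inl _ _,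
    Limits.pushout.map (Limits.Sigma.desc (fun i ↦ b i ≫ c.incl _)) (Limits.Sigma.map x)
      (Limits.Sigma.desc (fun i ↦ b i ≫ c.incl _))
      (Limits.Sigma.map (fun i ↦ x i ≫ y i)) (𝟙 Y) (Limits.Sigma.map y) (𝟙 (∐ B)) (by simp)
      (by ext; simp), ?_, ?_⟩
  · rw [Category.assoc]
    exact hP _ (RespectsIso.precomp (transfiniteCompositions.{w} P) e.hom _ h)
  · have := of_isPushout (IsPushout.of_hasPushout (Limits.Sigma.desc (fun i ↦ b i ≫ c.incl _))
      (Limits.Sigma.map (fun i ↦ x i ≫ y i))) (hP _ (transfiniteCompositions_sigmaMap _ h₂))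
    convert this using 1
    exact (Limits.pushout.inl_desc _ _ _).trans (Category.id_comp _)

end CategoryTheory.MorphismProperty

/-! ### Complements on model categories -/

namespace HomotopicalAlgebra

section

variable {C : Type u} [Category.{v} C] [ModelCategory C]

lemma exists_extension {A B X : C} (j : A ⟶ B) [Cofibration j] [WeakEquivalence j] [IsFibrant X]
    (g : A ⟶ X) : ∃ l : B ⟶ X, j ≫ l = g := by
  have sq : CommSq g j (terminal.from X) (terminal.from B) := ⟨by simp⟩
  exact ⟨sq.lift, sq.fac_left⟩

lemma IsFibrant.of_retract {X Y : C} (h : Retract X Y) [hY : IsFibrant Y] : IsFibrant X := by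
  have : RetractArrow (terminal.from X) (terminal.from Y) :=
    { i := Arrow.homMk h.i (𝟙 _) (by simp)
      r := Arrow.homMk h.r (𝟙 _) (by simp) }
  rw [isFibrant_iff, fibration_iff] at hY ⊢
  exact (fibrations C).of_retract this hY

/-- The trivial fibration `F.p` factors through `x`, so the pullback of `x` along a cofibrant
replacement of `C'` has a section `s`. Two-out-of-three with `x ≫ y` makes the idempotent `snd ≫ s`
a weak equivalence, and `snd` is a retract of it. -/
lemma weakEquivalence_of_fibration_of_twoOutOfSix {A B C' D : C} (f : A ⟶ B) (x : B ⟶ C')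
    (y : C' ⟶ D) [Fibration x] [WeakEquivalence (f ≫ x)] [WeakEquivalence (x ≫ y)] :
    WeakEquivalence x := by
  let F := MorphismProperty.factorizationData (trivialCofibrations C) (fibrations C) (f ≫ x)
  have : WeakEquivalence F.p := weakEquivalence_of_precomp_of_fac F.fac
  have sq : CommSq f F.i x F.p := ⟨by simp⟩
  let G := MorphismProperty.factorizationData (cofibrations C) (trivialFibrations C)
    (initial.to C')
  have : WeakEquivalence G.p := inferInstance
  have sq' : CommSq (initial.to F.Z) G.i F.p G.p := ⟨by simp⟩
  let s : G.Z ⟶ pullback x G.p := pullback.lift (sq'.lift ≫ sq.lift) (𝟙 _) (by simp)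
  have hs : s ≫ pullback.snd _ _ = 𝟙 _ := pullback.lift_snd _ _ _
  have h₁ : WeakEquivalence (pullback.snd x G.p ≫ G.p ≫ y) := by
    rw [← pullback.condition_assoc]
    infer_instance
  have h₂ : WeakEquivalence (pullback.snd x G.p ≫ s) :=
    weakEquivalence_of_postcomp_of_fac (g := pullback.snd x G.p ≫ G.p ≫ y)
      (fg := pullback.snd x G.p ≫ G.p ≫ y) (by simp [reassoc_of% hs])
  have r : RetractArrow (pullback.snd x G.p) (pullback.snd x G.p ≫ s) :=
    { i := Arrow.homMk (𝟙 _) s (by simp)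
      r := Arrow.homMk (𝟙 _) (pullback.snd x G.p) (by simp [hs])
      retract := by ext <;> simp [hs] }
  have : WeakEquivalence (pullback.snd x G.p) := by
    rw [weakEquivalence_iff] at h₂ ⊢
    exact (weakEquivalences C).of_retract r h₂
  exact weakEquivalence_of_precomp_of_fac (f := pullback.fst x G.p) pullback.condition

lemma weakEquivalence_of_twoOutOfSix {A B C' D : C} (f : A ⟶ B) (x : B ⟶ C')
    (y : C' ⟶ D) [WeakEquivalence (f ≫ x)] [WeakEquivalence (x ≫ y)] : WeakEquivalence f := by
  let F := MorphismProperty.factorizationData (trivialCofibrations C) (fibrations C) x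
  have : WeakEquivalence (F.p ≫ y) := weakEquivalence_of_precomp_of_fac (f := F.i) (F.fac_assoc y)
  have : WeakEquivalence ((f ≫ F.i) ≫ F.p) := by simpa
  have := weakEquivalence_of_fibration_of_twoOutOfSix (f ≫ F.i) F.p y
  have : WeakEquivalence x := by
    rw [← F.fac]
    infer_instance
  exact weakEquivalence_of_postcomp f x

/-- Replacing `w` by its Brown factorization, `h` and `g` glue to a morphism out of `pushout i₁
F.i`, which is weakly equivalent to `B₂`. Attaching `B₂` along `F.s` and replacing the result gives
a trivial cofibration to extend along; restriction to `B₂` works because `F.s` is a section of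
`F.p`. -/
lemma exists_extension_of_weakEquivalence {A₁ A₂ B₁ B₂ X : C} (i₁ : A₁ ⟶ B₁) (i₂ : A₂ ⟶ B₂)
    (w : A₁ ⟶ A₂) (w' : B₁ ⟶ B₂) (fac : i₁ ≫ w' = w ≫ i₂) [Cofibration i₁] [Cofibration i₂]
    [WeakEquivalence w] [WeakEquivalence w'] [IsCofibrant A₁] [IsCofibrant A₂] [IsFibrant X]
    (g : A₂ ⟶ X) (h : B₁ ⟶ X) (hg : i₁ ≫ h = w ≫ g) : ∃ l : B₂ ⟶ X, i₂ ≫ l = g := by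
  let F : CofibrantBrownFactorization w := Classical.arbitrary _
  let p : pushout i₁ F.i ⟶ B₂ := pushout.desc w' (F.p ≫ i₂) (by simp [fac])
  have hp : pushout.inl _ _ ≫ p = w' := pushout.inl_desc _ _ _
  have hp' : pushout.inr _ _ ≫ p = F.p ≫ i₂ := pushout.inr_desc _ _ _
  have : WeakEquivalence p := weakEquivalence_of_precomp_of_fac hp
  let q : pushout (F.s ≫ pushout.inr i₁ F.i) i₂ ⟶ B₂ := pushout.desc p (𝟙 _) (by simp [hp'])
  have hq : pushout.inl _ _ ≫ q = p := pushout.inl_desc _ _ _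
  let G := MorphismProperty.factorizationData (cofibrations C) (trivialFibrations C) q
  have : WeakEquivalence (pushout.inl (F.s ≫ pushout.inr i₁ F.i) i₂ ≫ G.i) :=
    weakEquivalence_of_postcomp_of_fac (g := G.p) (fg := p) (by simp [hq])
  obtain ⟨l, hl⟩ := exists_extension (pushout.inl (F.s ≫ pushout.inr i₁ F.i) i₂ ≫ G.i)
    (pushout.desc h (F.p ≫ g) (by simp [hg]))
  refine ⟨pushout.inr _ _ ≫ G.i ≫ l, ?_⟩
  rw [← pushout.condition_assoc]
  simp only [Category.assoc] at hl ⊢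
  rw [hl, pushout.inr_desc, F.s_p_assoc]

end

end HomotopicalAlgebra

/-! ### Model structures as explicit arguments -/

namespace HomotopicalAlgebra.ModelCategory

variable {C : Type u} [Category.{v} C] (𝓜 : ModelCategory C)

instance : 𝓜.weq.HasTwoOutOfThreeProperty := 𝓜.cm2

instance : 𝓜.weq.IsStableUnderRetracts := 𝓜.cm3a

instance : 𝓜.fib.IsStableUnderRetracts := 𝓜.cm3b

instance : 𝓜.cof.IsStableUnderRetracts := 𝓜.cm3c

instance : MorphismProperty.IsWeakFactorizationSystem 𝓜.trivCof 𝓜.fib :=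
  let := 𝓜
  inferInstanceAs (MorphismProperty.IsWeakFactorizationSystem (trivialCofibrations C)
    (fibrations C))

instance : MorphismProperty.IsWeakFactorizationSystem 𝓜.cof 𝓜.trivFib :=
  let := 𝓜
  inferInstanceAs (MorphismProperty.IsWeakFactorizationSystem (cofibrations C)
    (trivialFibrations C))

instance : 𝓜.weq.IsMultiplicative :=
  let := 𝓜
  inferInstanceAs (weakEquivalences C).IsMultiplicative

lemma trivCof_eq_llp : 𝓜.trivCof = 𝓜.fib.llp :=
  (MorphismProperty.llp_eq_of_wfs _ _).symm

lemma cof_eq_llp : 𝓜.cof = 𝓜.trivFib.llp :=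
  (MorphismProperty.llp_eq_of_wfs _ _).symm

lemma fib_eq_rlp : 𝓜.fib = 𝓜.trivCof.rlp :=
  (MorphismProperty.rlp_eq_of_wfs _ _).symm

lemma trivFib_eq_rlp : 𝓜.trivFib = 𝓜.cof.rlp :=
  (MorphismProperty.rlp_eq_of_wfs _ _).symm

instance : 𝓜.fib.IsMultiplicative := by
  rw [fib_eq_rlp]
  infer_instance

instance : 𝓜.cof.IsMultiplicative := by
  rw [cof_eq_llp]
  infer_instance

instance : 𝓜.trivFib.IsStableUnderBaseChange := by
  rw [trivFib_eq_rlp]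
  infer_instance

variable {𝓜}

lemma cofibrantObj_iff_of_isInitial {A B : C} (i : A ⟶ B) (hA : IsInitial A) :
    𝓜.CofibrantObj B ↔ 𝓜.cof i :=
  let := 𝓜
  (isCofibrant_iff_of_isInitial i hA).trans (cofibration_iff i)

lemma fibrantObj_iff_of_isTerminal {A B : C} (p : A ⟶ B) (hB : IsTerminal B) :
    𝓜.FibrantObj A ↔ 𝓜.fib p :=
  let := 𝓜
  (isFibrant_iff_of_isTerminal p hB).trans (fibration_iff p)

lemma CofibrantObj.of_cof {A B : C} (hA : 𝓜.CofibrantObj A) {i : A ⟶ B} (hi : 𝓜.cof i) :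
    𝓜.CofibrantObj B := by
  let := 𝓜
  have : Cofibration i := ⟨hi⟩
  exact isCofibrant_of_cofibration i

lemma FibrantObj.of_fib {A B : C} (hB : 𝓜.FibrantObj B) {p : A ⟶ B} (hp : 𝓜.fib p) :
    𝓜.FibrantObj A := by
  let := 𝓜
  have : Fibration p := ⟨hp⟩
  exact isFibrant_of_fibration p

lemma FibrantObj.of_retract {X Y : C} (hY : 𝓜.FibrantObj Y) (h : Retract X Y) :
    𝓜.FibrantObj X :=
  let := 𝓜
  IsFibrant.of_retract h

lemma FibrantObj.exists_extension {A B X : C} (hX : 𝓜.FibrantObj X) {j : A ⟶ B}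
    (hj : 𝓜.trivCof j) (g : A ⟶ X) : ∃ l : B ⟶ X, j ≫ l = g := by
  let := 𝓜
  have : Cofibration j := ⟨hj.1⟩
  have : WeakEquivalence j := ⟨hj.2⟩
  exact HomotopicalAlgebra.exists_extension j g

lemma CofibrantObj.exists_lift {A X Y : C} (hA : 𝓜.CofibrantObj A) {p : X ⟶ Y}
    (hp : 𝓜.trivFib p) (g : A ⟶ Y) : ∃ l : A ⟶ X, l ≫ p = g := by
  let := 𝓜
  have : Fibration p := ⟨hp.1⟩
  have : WeakEquivalence p := ⟨hp.2⟩
  have sq : CommSq (initial.to X) (initial.to A) p g := ⟨by simp⟩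
  exact ⟨sq.lift, sq.fac_right⟩

variable (𝓜) in
lemma exists_cofibrant_replacement (X : C) :
    ∃ (Q : C) (q : Q ⟶ X), 𝓜.CofibrantObj Q ∧ 𝓜.trivFib q := by
  let := 𝓜
  let F := MorphismProperty.factorizationData (cofibrations C) (trivialFibrations C)
    (initial.to X)
  exact ⟨F.Z, F.p, (cofibrantObj_iff_of_isInitial F.i initialIsInitial).2 F.hi, F.hp⟩

variable (𝓜) in
lemma exists_fibrant_replacement (X : C) :
    ∃ (R : C) (r : X ⟶ R), 𝓜.FibrantObj R ∧ 𝓜.trivCof r := by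
  let := 𝓜
  let F := MorphismProperty.factorizationData (trivialCofibrations C) (fibrations C)
    (terminal.from X)
  exact ⟨F.Z, F.i, (fibrantObj_iff_of_isTerminal F.p terminalIsTerminal).2 F.hp, F.hi⟩

lemma twoOutOfSix_weq_le : 𝓜.weq.twoOutOfSix ≤ 𝓜.weq := by
  let := 𝓜
  rintro _ _ f ⟨_, _, x, y, h₁, h₂⟩
  have : WeakEquivalence (f ≫ x) := ⟨h₁⟩
  have : WeakEquivalence (x ≫ y) := ⟨h₂⟩
  exact (weakEquivalence_of_twoOutOfSix f x y).mem

lemma exists_extension_of_weq {A₁ A₂ B₁ B₂ X : C} {i₁ : A₁ ⟶ B₁} {i₂ : A₂ ⟶ B₂}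
    {w : A₁ ⟶ A₂} {w' : B₁ ⟶ B₂} (fac : i₁ ≫ w' = w ≫ i₂) (hi₁ : 𝓜.cof i₁) (hi₂ : 𝓜.cof i₂)
    (hw : 𝓜.weq w) (hw' : 𝓜.weq w') (hA₁ : 𝓜.CofibrantObj A₁) (hA₂ : 𝓜.CofibrantObj A₂)
    (hX : 𝓜.FibrantObj X) (g : A₂ ⟶ X) (h : B₁ ⟶ X) (hg : i₁ ≫ h = w ≫ g) :
    ∃ l : B₂ ⟶ X, i₂ ≫ l = g := by
  let := 𝓜
  have : Cofibration i₁ := ⟨hi₁⟩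
  have : Cofibration i₂ := ⟨hi₂⟩
  have : WeakEquivalence w := ⟨hw⟩
  have : WeakEquivalence w' := ⟨hw'⟩
  exact exists_extension_of_weakEquivalence i₁ i₂ w w' fac g h hg

/-- Ken Brown's lemma for contravariant functors. -/
lemma weq_map_op_of_cofibrant {D : Type u'} [Category.{v} D] (𝓝 : ModelCategory D) (F : Cᵒᵖ ⥤ D)
    (hF : ∀ ⦃A B : C⦄ (i : A ⟶ B), 𝓜.CofibrantObj A → 𝓜.trivCof i → 𝓝.weq (F.map i.op))
    {A B : C} (w : A ⟶ B) (hA : 𝓜.CofibrantObj A) (hB : 𝓜.CofibrantObj B) (hw : 𝓜.weq w) :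
    𝓝.weq (F.map w.op) := by
  let := 𝓜
  have : WeakEquivalence w := ⟨hw⟩
  let f : CofibrantBrownFactorization w := Classical.arbitrary _
  have hi := hF f.i hA ⟨f.hi, mem_weakEquivalences f.i⟩
  have hs := hF f.s hB ⟨f.cofibration_s.mem, mem_weakEquivalences f.s⟩
  have hp : 𝓝.weq (F.map f.p.op) := by
    refine 𝓝.weq.of_postcomp _ (F.map f.s.op) hs ?_
    rw [← F.map_comp, ← op_comp, f.s_p, op_id, F.map_id]
    exact 𝓝.weq.id_mem _
  rw [← f.fac, op_comp, F.map_comp]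
  exact 𝓝.weq.comp_mem _ _ hp hi

/-- The dual form of Ken Brown's lemma. -/
lemma weq_map_of_fibrant {D : Type u'} [Category.{v} D] (𝓝 : ModelCategory D) (F : C ⥤ D)
    (hF : ∀ ⦃X Y : C⦄ (p : X ⟶ Y), 𝓜.FibrantObj Y → 𝓜.trivFib p → 𝓝.weq (F.map p))
    {X Y : C} (w : X ⟶ Y) (hX : 𝓜.FibrantObj X) (hY : 𝓜.FibrantObj Y) (hw : 𝓜.weq w) :
    𝓝.weq (F.map w) := by
  let := 𝓜
  have : WeakEquivalence w := ⟨hw⟩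
  let f : FibrantBrownFactorization w := Classical.arbitrary _
  have hp := hF f.p hY ⟨f.hp, mem_weakEquivalences f.p⟩
  have hr := hF f.r hX ⟨f.fibration_r.mem, mem_weakEquivalences f.r⟩
  have hi : 𝓝.weq (F.map f.i) := by
    refine 𝓝.weq.of_postcomp _ (F.map f.r) hr ?_
    rw [← F.map_comp, f.i_r, F.map_id]
    exact 𝓝.weq.id_mem _
  rw [← f.fac, F.map_comp]
  exact 𝓝.weq.comp_mem _ _ hi hp

end HomotopicalAlgebra.ModelCategory

/-! ### Hom objects in model `V`-categories -/

section

variable {V : Type u'} [Category.{v} V] [MonoidalCategory V] {M : Type u} [Category.{v} M]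

namespace ClosedModule

variable [ClosedModule V M]

instance (v : V) : ((MonoidalLeftAction.curriedAction V M).obj v).IsLeftAdjoint :=
  ((cotensorAdj (V := V) (M := M)).adj v).isLeftAdjoint

instance (X : M) : ((homObj (V := V) (M := M)).obj (Opposite.op X)).IsRightAdjoint :=
  ((homAdj (V := V) (M := M)).adj X).isRightAdjoint

instance (X : M) : ((MonoidalLeftAction.curriedAction V M).flip.obj X).IsLeftAdjoint :=
  ((homAdj (V := V) (M := M)).adj X).isLeftAdjoint

/-- The hom objects out of an initial object are terminal. -/
noncomputable def isTerminalHomObj {A : M} (hA : IsInitial A) (X : M) :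
    IsTerminal (((homObj (V := V)).obj (Opposite.op A)).obj X) :=
  IsTerminal.ofUniqueHom
    (fun v ↦ (homAdj (V := V) (M := M)).homEquiv
      ((hA.isInitialObj ((MonoidalLeftAction.curriedAction V M).obj v)).to X))
    (fun v _ ↦ ((homAdj (V := V) (M := M)).homEquiv).symm.injective
      ((hA.isInitialObj ((MonoidalLeftAction.curriedAction V M).obj v)).hom_ext _ _))

end ClosedModule

namespace IsModelVCategory

open ClosedModule HomotopicalAlgebra.ModelCategory

variable [ClosedModule V M] {𝓥 : ModelCategory V} {𝓜 : ModelCategory M}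
  (h : IsModelVCategory 𝓥 𝓜) {A B X Y : M} {s : A ⟶ B} {p : X ⟶ Y}

include h

/-- The pushout-product axiom transposed along the adjunction between tensors and hom objects. -/
lemma trivFib_π [HasPushouts M] (sq : (homObj (V := V)).PullbackObjObj s p) (hs : 𝓜.cof s)
    (hp : 𝓜.fib p) (h' : 𝓜.weq s ∨ 𝓜.weq p) : 𝓥.trivFib sq.π := by
  rw [trivFib_eq_rlp]
  intro K L i hi
  let sq' := Functor.PushoutObjObj.ofHasPushout (MonoidalLeftAction.curriedAction V M) i s
  rw [← homAdj.hasLiftingProperty_iff sq'.flip sq]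
  obtain ⟨h₁, h₂⟩ := h.pushoutProduct i s sq' hi hs
  obtain h' | h' := h'
  · exact (trivCof_eq_llp 𝓜 ▸ (⟨h₁, h₂ (.inr h')⟩ : 𝓜.trivCof sq'.ι) : 𝓜.fib.llp sq'.ι) _ hp
  · exact (cof_eq_llp 𝓜 ▸ h₁ : 𝓜.trivFib.llp sq'.ι) _ ⟨hp, h'⟩

lemma fib_π [HasPushouts M] (sq : (homObj (V := V)).PullbackObjObj s p) (hs : 𝓜.cof s)
    (hp : 𝓜.fib p) : 𝓥.fib sq.π := by
  rw [fib_eq_rlp]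
  intro K L i hi
  let sq' := Functor.PushoutObjObj.ofHasPushout (MonoidalLeftAction.curriedAction V M) i s
  rw [← homAdj.hasLiftingProperty_iff sq'.flip sq]
  obtain ⟨h₁, h₂⟩ := h.pushoutProduct i s sq' hi.1 hs
  exact (trivCof_eq_llp 𝓜 ▸ (⟨h₁, h₂ (.inl hi.2)⟩ : 𝓜.trivCof sq'.ι) : 𝓜.fib.llp sq'.ι) _ hp

lemma trivFib_homObj_map_app [HasPushouts M] (hs : 𝓜.trivCof s) (hX : 𝓜.FibrantObj X) :
    𝓥.trivFib (((homObj (V := V)).map s.op).app X) :=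
  let := 𝓜
  h.trivFib_π (.ofIsTerminal homObj s (terminal.from X) terminalIsTerminal) hs.1
    ((fibrantObj_iff_of_isTerminal _ terminalIsTerminal).1 hX) (.inl hs.2)

lemma fib_homObj_map_app [HasPushouts M] (hs : 𝓜.cof s) (hX : 𝓜.FibrantObj X) :
    𝓥.fib (((homObj (V := V)).map s.op).app X) :=
  let := 𝓜
  h.fib_π (.ofIsTerminal homObj s (terminal.from X) terminalIsTerminal) hs
    ((fibrantObj_iff_of_isTerminal _ terminalIsTerminal).1 hX)

lemma trivFib_homObj_obj_map [HasPushouts M] (hA : 𝓜.CofibrantObj A) (hp : 𝓜.trivFib p) :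
    𝓥.trivFib (((homObj (V := V)).obj (.op A)).map p) :=
  let := 𝓜
  have hX := isTerminalHomObj (V := V) (initialIsInitial (C := M)) X
  have hY := isTerminalHomObj (V := V) (initialIsInitial (C := M)) Y
  h.trivFib_π (s := initial.to A)
    { pt := ((homObj (V := V)).obj (.op A)).obj Y
      fst := hX.from _
      snd := 𝟙 _
      isPullback :=
        have := isIso_of_isTerminal hX hY (((homObj (V := V)).obj (.op (⊥_ M))).map p)
        .of_vert_isIso ⟨hY.hom_ext _ _⟩
      π := ((homObj (V := V)).obj (.op A)).map p
      π_fst := hX.hom_ext _ _ } ((cofibrantObj_iff_of_isInitial _ initialIsInitial).1 hA) hp.1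
      (.inr hp.2)

lemma weq_homObj_map_app [HasPushouts M] (hA : 𝓜.CofibrantObj A) (hB : 𝓜.CofibrantObj B)
    (hs : 𝓜.weq s) (hX : 𝓜.FibrantObj X) : 𝓥.weq (((homObj (V := V)).map s.op).app X) :=
  weq_map_op_of_cofibrant (𝓜 := 𝓜) 𝓥 ((homObj (V := V)).flip.obj X)
    (fun _ _ _ _ hi ↦ (h.trivFib_homObj_map_app hi hX).2) s hA hB hs

lemma weq_homObj_obj_map [HasPushouts M] (hA : 𝓜.CofibrantObj A) (hX : 𝓜.FibrantObj X)
    (hY : 𝓜.FibrantObj Y) (hp : 𝓜.weq p) : 𝓥.weq (((homObj (V := V)).obj (.op A)).map p) :=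
  weq_map_of_fibrant (𝓜 := 𝓜) 𝓥 ((homObj (V := V)).obj (.op A))
    (fun _ _ _ _ hp ↦ (h.trivFib_homObj_obj_map hA hp).2) p hX hY hp

/-- Invariance of derived hom objects: one choice of approximations suffices to verify
`IsRHomEquiv`. -/
lemma weq_homObj_iff [HasPushouts M] {A' B' X' : M} {s' : A' ⟶ B'}
    {a : A' ⟶ A} {b : B' ⟶ B} {x : X ⟶ X'} (w : s' ≫ b = a ≫ s)
    (hA : 𝓜.CofibrantObj A) (hB : 𝓜.CofibrantObj B) (hA' : 𝓜.CofibrantObj A')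
    (hB' : 𝓜.CofibrantObj B') (hX : 𝓜.FibrantObj X) (hX' : 𝓜.FibrantObj X') (ha : 𝓜.weq a)
    (hb : 𝓜.weq b) (hx : 𝓜.weq x) :
    𝓥.weq (((homObj (V := V)).map s.op).app X) ↔ 𝓥.weq (((homObj (V := V)).map s'.op).app X') := by
  have e : ((homObj (V := V)).map s.op).app X ≫ ((homObj (V := V)).map a.op).app X =
      ((homObj (V := V)).map b.op).app X ≫ ((homObj (V := V)).map s'.op).app X := by
    simp only [← NatTrans.comp_app, ← Functor.map_comp, ← op_comp, w]
  have e' : ((homObj (V := V)).map s.op).app X ≫ ((homObj (V := V)).map a.op).app X ≫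
        ((homObj (V := V)).obj (.op A')).map x =
      (((homObj (V := V)).map b.op).app X ≫ ((homObj (V := V)).obj (.op B')).map x) ≫
        ((homObj (V := V)).map s'.op).app X' := by
    rw [reassoc_of% e, Category.assoc, NatTrans.naturality]
  rw [← 𝓥.weq.postcomp_iff _ _ (𝓥.weq.comp_mem _ _ (h.weq_homObj_map_app hA' hA ha hX)
    (h.weq_homObj_obj_map hA' hX hX' hx)), e', 𝓥.weq.precomp_iff _ _ (𝓥.weq.comp_mem _ _
      (h.weq_homObj_map_app hB' hB hb hX) (h.weq_homObj_obj_map hB' hX hX' hx))]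

/-- The map factors as the pullback-hom of `s` and `p`, a trivial fibration by adjunction, followed
by a base change of the corresponding map for `Y`. -/
lemma trivFib_homObj_desc [HasPushouts M] [HasPullbacks V]
    (I : MorphismProperty V) (hI : 𝓥.trivFib = I.rlp)
    (hp : ∀ ⦃K L : V⦄ (i : K ⟶ L), I i → HasLiftingProperty
      (Functor.PushoutObjObj.ofHasPushout (MonoidalLeftAction.curriedAction V M) i s).ι p)
    (hY : 𝓥.weq (((homObj (V := V)).map s.op).app Y)) (hs : 𝓜.cof s) (hY' : 𝓜.FibrantObj Y) :
    𝓥.trivFib (((homObj (V := V)).map s.op).app X) := by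
  let sq := Functor.PullbackObjObj.ofHasPullback (homObj (V := V)) s p
  have h₁ : 𝓥.trivFib sq.π := by
    rw [hI]
    intro K L i hi
    rw [← homAdj.hasLiftingProperty_iff (Functor.PushoutObjObj.ofHasPushout
      (MonoidalLeftAction.curriedAction V M) i s).flip sq]
    exact hp i hi
  have h₂ : 𝓥.trivFib sq.fst :=
    MorphismProperty.of_isPullback sq.isPullback.flip ⟨h.fib_homObj_map_app hs hY', hY⟩
  rw [← sq.π_fst]
  exact ⟨𝓥.fib.comp_mem _ _ h₁.1 h₂.1, 𝓥.weq.comp_mem _ _ h₁.2 h₂.2⟩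

lemma cof_action [HasPushouts M] {Q : V} (hQ : 𝓥.CofibrantObj Q)
    (hs : 𝓜.cof s) : 𝓜.cof (Q ⊴ₗ s) :=
  let := 𝓥
  (h.pushoutProduct (initial.to Q) s (.ofIsInitialLeft _ _ _ initialIsInitial)
    ((cofibrantObj_iff_of_isInitial _ initialIsInitial).1 hQ) hs).1

lemma cofibrantObj_action [HasPushouts M] {Q : V}
    (hQ : 𝓥.CofibrantObj Q) (hA : 𝓜.CofibrantObj A) : 𝓜.CofibrantObj (Q ⊙ₗ A) :=
  let := 𝓜
  (cofibrantObj_iff_of_isInitial _ (initialIsInitial.isInitialObj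
    ((MonoidalLeftAction.curriedAction V M).obj Q))).2 (h.cof_action hQ
      ((cofibrantObj_iff_of_isInitial (initial.to A) initialIsInitial).1 hA))

/-- Extension of morphisms to a fibrant object `X` along cofibrations inducing weak equivalences
between hom objects. -/
lemma exists_extension [HasPushouts M] (hs : 𝓜.cof s)
    (hA : 𝓜.CofibrantObj A) (hX : 𝓜.FibrantObj X)
    (hs' : 𝓥.weq (((homObj (V := V)).map s.op).app X)) (g : A ⟶ X) :
    ∃ l : B ⟶ X, s ≫ l = g := by
  -- The unit may fail to be cofibrant, so `g` cannot be lifted as a point of the hom object. The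
  -- problem is solved for `Q ⊴ₗ s` and transferred to `s` by the unit axiom.
  obtain ⟨Q, q, hQ, hq⟩ := 𝓥.exists_cofibrant_replacement (𝟙_ V)
  have hw (A : M) (hA : 𝓜.CofibrantObj A) : 𝓜.weq (q ⊵ₗ A ≫ (λₗ[V] A).hom) :=
    MorphismProperty.RespectsIso.postcomp 𝓜.weq _ _ (h.unit q A hQ hq hA)
  obtain ⟨l, hl⟩ := hQ.exists_lift ⟨h.fib_homObj_map_app hs hX, hs'⟩
    ((homAdj (V := V) (M := M)).homEquiv (q ⊵ₗ A ≫ (λₗ[V] A).hom ≫ g))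
  refine exists_extension_of_weq (i₁ := Q ⊴ₗ s) (w' := q ⊵ₗ B ≫ (λₗ[V] B).hom) ?_
    (h.cof_action hQ hs) hs (hw A hA) (hw B (hA.of_cof hs)) (h.cofibrantObj_action hQ hA) hA hX g
    ((homAdj (V := V) (M := M)).homEquiv.symm l) ?_
  · simp [MonoidalLeftAction.action_exchange_assoc]
  · apply (homAdj (V := V) (M := M)).homEquiv.injective
    rw [Category.assoc]
    refine ((homAdj (V := V) (M := M)).homEquiv_naturality_one s _).trans ?_
    rw [Equiv.apply_symm_apply]
    exact hl

end IsModelVCategory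

end

/-! ### Fibrant objects of enriched left Bousfield localizations -/

namespace IsEnrichedBousfieldLocalization

open ClosedModule HomotopicalAlgebra.ModelCategory

variable {V : Type u'} [Category.{v} V] [MonoidalCategory V] {M : Type u} [Category.{v} M]
  [ClosedModule V M] {𝓥 : ModelCategory V} {𝓜 𝓛 : ModelCategory M} {S : MorphismProperty M}

lemma trivFib_eq (h : IsEnrichedBousfieldLocalization 𝓥 𝓜 S 𝓛) : 𝓛.trivFib = 𝓜.trivFib := by
  rw [trivFib_eq_rlp, trivFib_eq_rlp, h.cof_eq]

lemma cofibrantObj_iff (h : IsEnrichedBousfieldLocalization 𝓥 𝓜 S 𝓛) (X : M) :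
    𝓛.CofibrantObj X ↔ 𝓜.CofibrantObj X := by
  let := 𝓜
  rw [cofibrantObj_iff_of_isInitial (initial.to X) initialIsInitial,
    cofibrantObj_iff_of_isInitial (initial.to X) initialIsInitial, h.cof_eq]

lemma trivCof_of_mem (h : IsEnrichedBousfieldLocalization 𝓥 𝓜 S 𝓛) {A B : M} {s : A ⟶ B}
    (hs : S s) (hs' : 𝓜.cof s) : 𝓛.trivCof s :=
  ⟨h.cof_eq ▸ hs', (h.weq_iff _).2 (fun _ hZ ↦ hZ s hs)⟩

/-- A weak equivalence of the localization between fibrant objects of the localization is a weak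
equivalence. -/
lemma weq_of_fibrantObj (h : IsEnrichedBousfieldLocalization 𝓥 𝓜 S 𝓛) {X Y : M} {f : X ⟶ Y}
    (hf : 𝓛.weq f) (hX : 𝓛.FibrantObj X) (hY : 𝓛.FibrantObj Y) : 𝓜.weq f :=
  -- Ken Brown's lemma for the identity functor: both structures have the same trivial fibrations.
  weq_map_of_fibrant (𝓜 := 𝓛) 𝓜 (𝟭 M)
    (fun _ _ _ _ hp ↦ (h.trivFib_eq ▸ hp : 𝓜.trivFib _).2) f hX hY hf

/-- Retract argument: in a factorization of `f` in `𝓛` all objects are fibrant, so the trivial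
cofibration `F.i` is one in `𝓜` too and lifts against `f`. -/
lemma fib_of_fibrantObj (h : IsEnrichedBousfieldLocalization 𝓥 𝓜 S 𝓛) {X Y : M} {f : X ⟶ Y}
    (hf : 𝓜.fib f) (hX : 𝓛.FibrantObj X) (hY : 𝓛.FibrantObj Y) : 𝓛.fib f := by
  let F := MorphismProperty.factorizationData 𝓛.trivCof 𝓛.fib f
  have hi : 𝓜.trivCof F.i := ⟨h.cof_eq ▸ F.hi.1, h.weq_of_fibrantObj F.hi.2 hX (hY.of_fib F.hp)⟩
  have := (fib_eq_rlp 𝓜 ▸ hf : 𝓜.trivCof.rlp f) _ hi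
  exact 𝓛.fib.of_retract (RetractArrow.ofRightLiftingProperty F.fac) F.hp

variable [HasPushouts M]

lemma weq_le (h : IsEnrichedBousfieldLocalization 𝓥 𝓜 S 𝓛) (h𝓜 : IsModelVCategory 𝓥 𝓜) :
    𝓜.weq ≤ 𝓛.weq := by
  intro A B f hf
  rw [h.weq_iff]
  intro Z _ A' B' Z' f' a b z w hA' hB' hZ' ha hb _
  exact h𝓜.weq_homObj_map_app hA' hB'
    (𝓜.weq.of_postcomp _ _ hb (w ▸ 𝓜.weq.comp_mem _ _ ha hf)) hZ'

lemma trivCof_le (h : IsEnrichedBousfieldLocalization 𝓥 𝓜 S 𝓛) (h𝓜 : IsModelVCategory 𝓥 𝓜) :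
    𝓜.trivCof ≤ 𝓛.trivCof :=
  fun _ _ _ hf ↦ ⟨h.cof_eq ▸ hf.1, h.weq_le h𝓜 _ hf.2⟩

lemma fib_le (h : IsEnrichedBousfieldLocalization 𝓥 𝓜 S 𝓛) (h𝓜 : IsModelVCategory 𝓥 𝓜) :
    𝓛.fib ≤ 𝓜.fib := by
  rw [fib_eq_rlp, fib_eq_rlp]
  exact MorphismProperty.antitone_rlp (h.trivCof_le h𝓜)

lemma fibrantObj (h : IsEnrichedBousfieldLocalization 𝓥 𝓜 S 𝓛) (h𝓜 : IsModelVCategory 𝓥 𝓜)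
    {X : M} (hX : 𝓛.FibrantObj X) : 𝓜.FibrantObj X := by
  let := 𝓜
  rw [fibrantObj_iff_of_isTerminal (terminal.from X) terminalIsTerminal] at hX ⊢
  exact h.fib_le h𝓜 _ hX

/-- A fibrant object `X` is local with respect to a class of morphisms between cofibrant objects if
these morphisms induce weak equivalences between the hom objects to `X`. -/
lemma isEnrichedLocal (h𝓜 : IsModelVCategory 𝓥 𝓜)
    (hS : ∀ ⦃A B : M⦄ (s : A ⟶ B), S s → 𝓜.cof s ∧ 𝓜.CofibrantObj A) {X : M}
    (hX : 𝓜.FibrantObj X)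
    (hX' : ∀ ⦃A B : M⦄ (s : A ⟶ B), S s → 𝓥.weq (((homObj (V := V)).map s.op).app X)) :
    IsEnrichedLocal 𝓥 𝓜 S X := by
  intro A B s hs A' B' Z' s' a b z w hA' hB' hZ' ha hb hz
  obtain ⟨h₁, h₂⟩ := hS s hs
  exact (h𝓜.weq_homObj_iff w h₂ (h₂.of_cof h₁) hA' hB' hX hZ' ha hb hz).1 (hX' s hs)

lemma exists_extension (h : IsEnrichedBousfieldLocalization 𝓥 𝓜 S 𝓛)
    (h𝓜 : IsModelVCategory 𝓥 𝓜)
    (hS : ∀ ⦃A B : M⦄ (s : A ⟶ B), S s → 𝓜.cof s ∧ 𝓜.CofibrantObj A) {X : M}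
    (hX : 𝓜.FibrantObj X)
    (hX' : ∀ ⦃A B : M⦄ (s : A ⟶ B), S s → 𝓥.weq (((homObj (V := V)).map s.op).app X))
    {A B : M} {j : A ⟶ B} (hj : 𝓛.trivCof j) (hA : 𝓜.CofibrantObj A) (g : A ⟶ X) :
    ∃ l : B ⟶ X, j ≫ l = g := by
  have hj' : 𝓜.cof j := h.cof_eq ▸ hj.1
  exact h𝓜.exists_extension hj' hA hX ((h.weq_iff j).1 hj.2 (isEnrichedLocal h𝓜 hS hX hX') j (𝟙 _)
    (𝟙 _) (𝟙 _) (by simp) hA (hA.of_cof hj') hX (𝓜.weq.id_mem _) (𝓜.weq.id_mem _)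
      (𝓜.weq.id_mem _)) g

/-- Extension along trivial cofibrations of `𝓛` is available only for cofibrant domains, so it is
applied to a cofibrant replacement `Q` of `X`. This makes `Q` a retract of an object fibrant in `𝓛`;
hence `r` is a weak equivalence of `𝓜`, and `X` is a retract of `R`. -/
lemma fibrantObj_of_local (h : IsEnrichedBousfieldLocalization 𝓥 𝓜 S 𝓛)
    (h𝓜 : IsModelVCategory 𝓥 𝓜)
    (hS : ∀ ⦃A B : M⦄ (s : A ⟶ B), S s → 𝓜.cof s ∧ 𝓜.CofibrantObj A) {X : M}
    (hX : 𝓜.FibrantObj X)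
    (hX' : ∀ ⦃A B : M⦄ (s : A ⟶ B), S s → 𝓥.weq (((homObj (V := V)).map s.op).app X)) :
    𝓛.FibrantObj X := by
  obtain ⟨R, r, hR, hr⟩ := 𝓛.exists_fibrant_replacement X
  obtain ⟨Q, q, hQ, hq⟩ := 𝓜.exists_cofibrant_replacement X
  have hQ' : 𝓜.FibrantObj Q := hX.of_fib hq.1
  let F := MorphismProperty.factorizationData 𝓜.cof 𝓜.trivFib (q ≫ r)
  have hF : 𝓛.weq F.i := 𝓛.weq.of_postcomp _ _ (h.weq_le h𝓜 _ F.hp.2) (by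
    rw [F.fac]
    exact 𝓛.weq.comp_mem _ _ (h.weq_le h𝓜 _ hq.2) hr.2)
  obtain ⟨l, hl⟩ := h.exists_extension h𝓜 hS hQ' (fun A B s hs ↦ by
    obtain ⟨h₁, h₂⟩ := hS s hs
    exact (h𝓜.weq_homObj_iff (a := 𝟙 A) (b := 𝟙 B) (by simp) h₂ (h₂.of_cof h₁) h₂ (h₂.of_cof h₁) hQ'
      hX (𝓜.weq.id_mem _) (𝓜.weq.id_mem _) hq.2).2 (hX' s hs)) ⟨h.cof_eq.ge _ F.hi, hF⟩ hQ (𝟙 Q)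
  have hZ : 𝓛.FibrantObj F.Z := hR.of_fib (h.trivFib_eq.ge _ F.hp).1
  have hF' : 𝓜.weq F.i := h.weq_of_fibrantObj hF (hZ.of_retract ⟨F.i, l, hl⟩) hZ
  have hr' : 𝓜.weq r := 𝓜.weq.of_precomp _ _ hq.2 (by
    rw [← F.fac]
    exact 𝓜.weq.comp_mem _ _ hF' F.hp.2)
  obtain ⟨l', hl'⟩ := hX.exists_extension ⟨h.cof_eq ▸ hr.1, hr'⟩ (𝟙 X)
  exact hR.of_retract ⟨r, l', hl'⟩

/-- A characterization of fibrations with fibrant codomain in the localization. -/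
lemma fib_of_rlp [HasPullbacks V] (h : IsEnrichedBousfieldLocalization 𝓥 𝓜 S 𝓛)
    (h𝓜 : IsModelVCategory 𝓥 𝓜)
    (hS : ∀ ⦃A B : M⦄ (s : A ⟶ B), S s → 𝓜.cof s ∧ 𝓜.CofibrantObj A) {I : MorphismProperty V}
    (hI : 𝓥.IsGeneratingCof I) {J : MorphismProperty M} (hJ : 𝓜.IsWeaklyGeneratingTrivCof J)
    {X Y : M} {f : X ⟶ Y} (hf : (J ⊔ pushoutProducts S I).rlp f) (hY : 𝓛.FibrantObj Y) :
    𝓛.fib f := by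
  have hY' := h.fibrantObj h𝓜 hY
  have hf' : 𝓜.fib f := hJ.fib_of_rlp f (fun _ _ _ hi ↦ hf _ (.inl hi)) hY'
  refine h.fib_of_fibrantObj hf' (h.fibrantObj_of_local h𝓜 hS (hY'.of_fib hf') (fun A B s hs ↦ ?_))
    hY
  obtain ⟨h₁, h₂⟩ := hS s hs
  exact (h𝓜.trivFib_homObj_desc I hI.trivFib_eq (fun K L i hi ↦ hf _ (.inr (.mk s i hs hi)))
    (h.isModelVCategory.trivFib_homObj_map_app (h.trivCof_of_mem hs h₁) hY).2 h₁ hY').2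

end IsEnrichedBousfieldLocalization

/-! ### Cellular morphisms -/

namespace CategoryTheory.MorphismProperty

variable {C : Type u} [Category.{v} C]

lemma PermitsSmallObjectArgument.exists_factorization {I : MorphismProperty C}
    (hI : I.PermitsSmallObjectArgument) {X Y : C} (f : X ⟶ Y) :
    ∃ (Z : C) (i : X ⟶ Z) (p : Z ⟶ Y), i ≫ p = f ∧
      transfiniteCompositions.{v} (coproducts.{v} I).pushouts i ∧ I.rlp p := by
  obtain ⟨I₀, h, h', _⟩ := hI
  have := smallObjectκ_isRegular I₀
  refine ⟨_, _, _, SmallObject.ιObj_πObj I₀ I₀.smallObjectκ f, ?_, ?_⟩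
  · exact transfiniteCompositionsOfShape_le_transfiniteCompositions _ _ _
      (transfiniteCompositionsOfShape_monotone _ (pushouts_monotone (coproducts_monotone h)) _
        (SmallObject.transfiniteCompositionsOfShape_ιObj _ _ _))
  · exact (le_llp_iff_le_rlp _ _).1 (h'.trans ((isoClosure_le_iff _ _).2 (I₀.le_llp_rlp))) _
      (SmallObject.rlp_πObj I₀ I₀.smallObjectκ f)

variable {D : Type u'} [Category.{v} D]

lemma map_mem_of_transfiniteCompositions_pushouts_coproducts {K : MorphismProperty D}
    [HasPushouts D] [HasCoproducts.{w} D]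
    [K.IsStableUnderCobaseChange] (hK : transfiniteCompositions.{w} K ≤ K) (G : C ⥤ D)
    [PreservesColimitsOfSize.{w, w} G] [PreservesColimitsOfShape WalkingSpan G]
    {I : MorphismProperty C} (hI : I ≤ K.inverseImage G) :
    transfiniteCompositions.{w} (coproducts.{w} I).pushouts ≤ K.inverseImage G := by
  have h₁ : coproducts.{w} I ≤ K.inverseImage G := by
    intro X Y f hf
    rw [coproducts_iff] at hf
    obtain ⟨J, hf⟩ := hf
    have : K.IsStableUnderCoproductsOfShape J := .mk _ _ (fun _ _ _ _ f hf ↦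
      hK _ (transfiniteCompositions_sigmaMap f hf))
    obtain ⟨X₁, X₂, c₁, c₂, h₁, h₂, f, hf⟩ := hf
    refine K.colimitsOfShape_le _ (.mk' (W := K) (X₁ ⋙ G) (X₂ ⋙ G) (G.mapCocone c₁)
      (G.mapCocone c₂) (isColimitOfPreserves G h₁) (isColimitOfPreserves G h₂)
      (Functor.whiskerRight f G) (fun j ↦ hI _ (hf j)) _ (fun j ↦ ?_))
    exact (G.map_comp _ _).symm.trans ((congr_arg G.map (h₁.fac _ j)).trans (G.map_comp _ _))
  have h₂ : (coproducts.{w} I).pushouts ≤ K.inverseImage G := by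
    rintro _ _ _ ⟨_, _, _, _, _, hf, sq⟩
    exact K.of_isPushout (sq.map G) (h₁ _ hf)
  intro X Y f hf
  rw [transfiniteCompositions_iff] at hf
  obtain ⟨J, _, _, _, _, hf⟩ := hf
  have : PreservesWellOrderContinuousOfShape J G := ⟨fun _ _ ↦ inferInstance⟩
  exact hK _ (transfiniteCompositionsOfShape_le_transfiniteCompositions _ J _
    (transfiniteCompositionsOfShape_map_of_preserves J G f
      (transfiniteCompositionsOfShape_monotone _ h₂ _ hf)))

variable [MonoidalCategory C]

/-- Tensoring `i` with the initial object gives a morphism between initial objects, and every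
isomorphism is a pushout of it. -/
lemma isomorphisms_le_pushouts_tensorObjects [HasInitial C] {I : MorphismProperty C}
    (hC : ∀ X : C, (tensorLeft X).IsLeftAdjoint) {A B : C} (i : A ⟶ B) (hi : I i) :
    isomorphisms C ≤ I.tensorObjects.pushouts := by
  have hI (X : C) : IsInitial (X ⊗ ⊥_ C) :=
    have := hC X
    initialIsInitial.isInitialObj (tensorLeft X)
  have := isIso_of_isInitial (hI A) (hI B) (i ▷ ⊥_ C)
  intro X Y e he
  have : IsIso e := he
  exact ⟨_, _, _, (hI A).to _, (hI B).to _, .mk i _ hi, .of_vert_isIso ⟨(hI A).hom_ext _ _⟩⟩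

lemma exists_le_of_cofReg_tensorObjects_le [HasInitial C] [HasPushouts C] (I W : MorphismProperty C)
    (hI : I.tensorObjects.cofReg ≤ W) (hW : isomorphisms C ≤ W)
    (hC : ∀ X : C, (tensorLeft X).IsLeftAdjoint) :
    ∃ K : MorphismProperty C, K.IsStableUnderCobaseChange ∧ transfiniteCompositions.{v} K ≤ K ∧
      I.tensorObjects ≤ K ∧ K ≤ W := by
  -- Concatenating sequences requires isomorphisms among the steps. A member of `I` provides them;
  -- for empty `I` the isomorphisms themselves serve as `K`.
  by_cases h : ∃ (A B : C) (i : A ⟶ B), I i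
  · obtain ⟨A, B, i, hi⟩ := h
    have := isStableUnderTransfiniteComposition_transfiniteCompositions.{v} _
      (isomorphisms_le_pushouts_tensorObjects hC i hi)
    exact ⟨I.tensorObjects.cofReg, inferInstance, transfiniteCompositions_le _,
      I.tensorObjects.le_pushouts.trans (le_transfiniteCompositions _), hI⟩
  · refine ⟨isomorphisms C, inferInstance, ?_, ?_, hW⟩
    · intro X Y f hf
      rw [transfiniteCompositions_iff] at hf
      obtain ⟨J, _, _, _, _, ⟨t⟩⟩ := hf
      exact t.isIso
    · rintro _ _ _ ⟨i, _, hi⟩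
      exact (h ⟨_, _, i, hi⟩).elim

end CategoryTheory.MorphismProperty

/-! ### The monoid axiom and the pushout-product axiom for the localization -/

/-- One leg into the pushout is a cobase change of a trivial cofibration tensored with an object,
and its composite with `sq.ι` is again such a tensor; two-out-of-three concludes. The braiding
handles tensoring on the other side. -/
lemma MonoidAxiom.pushoutProductAxiom {C : Type u} [Category.{v} C] [MonoidalCategory C]
    [BraidedCategory C] {𝓜 : ModelCategory C} (h : MonoidAxiom 𝓜)
    (h' : ∀ ⦃A₁ B₁ A₂ B₂ : C⦄ (f₁ : A₁ ⟶ B₁) (f₂ : A₂ ⟶ B₂)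
      (sq : (curriedTensor C).PushoutObjObj f₁ f₂), 𝓜.cof f₁ → 𝓜.cof f₂ → 𝓜.cof sq.ι) :
    PushoutProductAxiom (curriedTensor C) 𝓜 𝓜 𝓜 := by
  have hP : 𝓜.trivCof.tensorObjects.pushouts ≤ 𝓜.weq :=
    (MorphismProperty.le_transfiniteCompositions _).trans h
  have hr {A B : C} (f : A ⟶ B) (X : C) (hf : 𝓜.trivCof f) :
      𝓜.trivCof.tensorObjects.pushouts (f ▷ X) :=
    MorphismProperty.le_pushouts _ _ (.mk f X hf)
  have hl {A B : C} (f : A ⟶ B) (X : C) (hf : 𝓜.trivCof f) :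
      𝓜.trivCof.tensorObjects.pushouts (X ◁ f) :=
    (MorphismProperty.arrow_mk_iso_iff _ (Arrow.isoMk (β_ X A) (β_ X B))).2 (hr f X hf)
  intro A₁ B₁ A₂ B₂ f₁ f₂ sq h₁ h₂
  refine ⟨h' f₁ f₂ sq h₁ h₂, ?_⟩
  rintro (h₃ | h₃)
  · refine 𝓜.weq.of_precomp sq.inr _ (hP _ (MorphismProperty.of_isPushout sq.isPushout.flip
      (hr f₁ A₂ ⟨h₁, h₃⟩))) ?_
    rw [sq.inr_ι]
    exact hP _ (hr f₁ B₂ ⟨h₁, h₃⟩)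
  · refine 𝓜.weq.of_precomp sq.inl _ (hP _ (MorphismProperty.of_isPushout sq.isPushout
      (hl f₂ A₁ ⟨h₂, h₃⟩))) ?_
    rw [sq.inl_ι]
    exact hP _ (hl f₂ B₁ ⟨h₂, h₃⟩)

namespace IsEnrichedBousfieldLocalization

open HomotopicalAlgebra.ModelCategory

variable {V : Type u'} [Category.{v} V] [MonoidalCategory V] {M : Type u} [Category.{v} M]
  [ClosedModule V M] {𝓥 : ModelCategory V} {𝓜 𝓛 : ModelCategory M} {S : MorphismProperty M}

/-- The detour through the fibrant object `Z` makes `q` a fibration of `𝓛`, so that `f` lifts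
against it. -/
lemma exists_cellular [HasPushouts M] [HasPullbacks V]
    (h : IsEnrichedBousfieldLocalization 𝓥 𝓜 S 𝓛) (h𝓜 : IsModelVCategory 𝓥 𝓜)
    (hS : ∀ ⦃A B : M⦄ (s : A ⟶ B), S s → 𝓜.cof s ∧ 𝓜.CofibrantObj A) {I : MorphismProperty V}
    (hI : 𝓥.IsGeneratingCof I) {J : MorphismProperty M} (hJ : 𝓜.IsWeaklyGeneratingTrivCof J)
    (hsmall : (J ⊔ pushoutProducts S I).PermitsSmallObjectArgument) {A B : M} {f : A ⟶ B}
    (hf : 𝓛.trivCof f) :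
    (MorphismProperty.transfiniteCompositions.{v} (MorphismProperty.coproducts.{v}
      (J ⊔ pushoutProducts S I)).pushouts).twoOutOfSix f := by
  let := 𝓛
  obtain ⟨Z, g, p, _, hg, hp⟩ := hsmall.exists_factorization (terminal.from B)
  have hZ : 𝓛.FibrantObj Z := (fibrantObj_iff_of_isTerminal p terminalIsTerminal).2
    (h.fib_of_rlp h𝓜 hS hI hJ hp ((fibrantObj_iff_of_isTerminal (𝟙 _) terminalIsTerminal).2
      (𝓛.fib.id_mem _)))
  obtain ⟨W, i, q, hfac, hi, hq⟩ := hsmall.exists_factorization (f ≫ g)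
  have := (fib_eq_rlp 𝓛 ▸ h.fib_of_rlp h𝓜 hS hI hJ hq hZ : 𝓛.trivCof.rlp q) _ hf
  have sq : CommSq i f q g := ⟨hfac⟩
  exact ⟨W, Z, sq.lift, q, by rwa [sq.fac_left], by rwa [sq.fac_right]⟩

end IsEnrichedBousfieldLocalization

/-! ### The localization theorem -/

theorem theorem1p1
    {V : Type u'} [Category.{v} V] [MonoidalCategory V]
    (𝓥 : ModelCategory V) (h𝓥 : IsMonoidalModelCategory 𝓥)
    (I_V : MorphismProperty V) (hI_V : 𝓥.IsGeneratingCof I_V)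
    {M : Type u} [Category.{v} M] [HasColimits M] [MonoidalCategory M] [BraidedCategory M]
    [MonoidalVCategory V M]
    (𝓜 : ModelCategory M) (h𝓜 : IsMonoidalModelVCategory 𝓥 𝓜)
    (J' : MorphismProperty M) (hJ' : 𝓜.IsWeaklyGeneratingTrivCof J')
    (S : MorphismProperty M)
    (hS : ∀ ⦃A B : M⦄ (s : A ⟶ B), S s → 𝓜.cof s ∧ 𝓜.CofibrantObj A)
    (LSM : ModelCategory M) (hLSM : IsEnrichedBousfieldLocalization 𝓥 𝓜 S LSM)
    (hsmall : (J' ⊔ pushoutProducts S I_V).PermitsSmallObjectArgument)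
    (hweq : (J' ⊔ pushoutProducts S I_V).tensorObjects.cofReg ≤ LSM.weq) :
    IsMonoidalModelVCategory 𝓥 LSM ∧ MonoidAxiom LSM := by
  have : HasPullbacks V := by
    have := 𝓥.cm1a
    infer_instance
  obtain ⟨h₁, h₂⟩ := h𝓜
  have hM : MonoidAxiom LSM := by
    -- The class `K` is interposed because weak equivalences themselves need not be closed under
    -- cobase change or transfinite composition.
    obtain ⟨K, _, hK, hK', hK''⟩ := MorphismProperty.exists_le_of_cofReg_tensorObjects_le _ _ hweq
      (fun X Y f (_ : IsIso f) ↦ LSM.weq.of_isIso f) h₁.closed_left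
    have hT : LSM.trivCof.tensorObjects ≤ K.twoOutOfSix := by
      rintro _ _ _ ⟨f, X, hf⟩
      have := h₁.closed_right X
      have hG := MorphismProperty.map_mem_of_transfiniteCompositions_pushouts_coproducts hK
        (tensorRight X) (I := J' ⊔ pushoutProducts S I_V) (fun _ _ i hi ↦ hK' _ (.mk i X hi))
      obtain ⟨W, Z, x, y, hx, hy⟩ := hLSM.exists_cellular h₂ hS hI_V hJ' hsmall hf
      exact ⟨W ⊗ X, Z ⊗ X, x ▷ X, y ▷ X, by simpa using! hG _ hx, by simpa using! hG _ hy⟩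
    have hW : K.twoOutOfSix ≤ LSM.weq := by
      rintro _ _ f ⟨W, Z, x, y, hx, hy⟩
      exact ModelCategory.twoOutOfSix_weq_le _ ⟨W, Z, x, y, hK'' _ hx, hK'' _ hy⟩
    exact (MorphismProperty.transfiniteCompositions_monotone
      (MorphismProperty.pushouts_monotone hT)).trans
        ((MorphismProperty.transfiniteCompositions_twoOutOfSix_le hK).trans hW)
  -- The remaining axioms descend from `𝓜`: cofibrations, and hence cofibrant objects and trivial
  -- fibrations, are unchanged, and weak equivalences only increase.
  refine ⟨⟨⟨h₁.closed_left, h₁.closed_right, hM.pushoutProductAxiom ?_, ?_, ?_⟩,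
    hLSM.isModelVCategory⟩, hM⟩
  · rw [hLSM.cof_eq]
    exact fun _ _ _ _ f₁ f₂ sq hf₁ hf₂ ↦ (h₁.pushoutProduct f₁ f₂ sq hf₁ hf₂).1
  · intro Q q X hQ hq hX
    rw [hLSM.cofibrantObj_iff] at hQ hX
    exact hLSM.weq_le h₂ _ (h₁.unit_left q X hQ (hLSM.trivFib_eq.le _ hq) hX)
  · intro Q q X hQ hq hX
    rw [hLSM.cofibrantObj_iff] at hQ hX
    exact hLSM.weq_le h₂ _ (h₁.unit_right q X hQ (hLSM.trivFib_eq.le _ hq) hX)
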